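/- Let $F$ be a non-Archimedean local field with ring of integers $\mathcal O$, uniformiser $\varpi$ and residue field $k$ of characteristic $p$, let $n\ge 0$, and let $R$ be an algebraically closed field of characteristic $l\neq p$. Put $G=\mathrm{GL}_n(F)$, $K=\mathrm{GL}_n(\mathcal O)$, $K^1=1+\varpi M_n(\mathcal O)$ and $G_f=\mathrm{GL}_n(k)=K/K^1$; all representations are over $R$, and $\mathrm{ind}$ denotes induction of finite groups, respectively compact induction from open subgroups of $G$. For a representation $\pi$ of $G_f$ let $\mathrm I(\pi)=\mathrm{ind}_K^G\,\mathrm{infl}_{G_f}^K\,\pi$ be its parahoric induction. Finite side. Let $B_f\subseteq G_f$ be the group of upper triangular matrices and $P_f=\mathrm{ind}_{B_f}^{G_f}\mathbf 1$. For each standard (block upper triangular) parabolic subgroup $J_f\supseteq B_f$ of $G_f$ let $M_{J_f}$ be its block diagonal Levi subgroup, $U_{J_f}\subseteq M_{J_f}$ the group of blockwise unipotent upper triangular matrices, and $X_{J_f}$ the set of characters $U_{J_f}\to R^\times$ that are nontrivial on every simple root group of $M_{J_f}$ and trivial on every non-simple positive root group. Let $$\Gamma_f=\bigoplus_{J_f}\bigoplus_{\chi\in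 X_{J_f}}\mathrm{ind}_{J_f}^{G_f}\,\mathrm{infl}_{M_{J_f}}^{J_f}\,\mathrm{ind}_{U_{J_f}}^{M_{J_f}}\chi ,$$ let $\mathcal I_f$ be the annihilator of $P_f$ in the group algebra $R[G_f]$, and let $Q_f=\Gamma_f/\mathcal I_f\Gamma_f$. $p$-adic side. Let $I\subseteq K$ be the Iwahori subgroup, that is, the preimage of $B_f$, and let $P=\mathrm{ind}_I^G\mathbf 1$. Let $\mathcal H(G)$ be the global Hecke algebra of locally constant compactly supported functions $G\to R$, acting on smooth representations through the $R$-valued Haar measure with $\mu(K^1)=1$, and let $\mathcal I$ be the annihilator of $P$ in $\mathcal H(G)$. Let $\Gamma=\mathrm I(\Gamma_f)$ and $Q=\Gamma/\mathcal I\,\Gamma$. Then $Q=\mathrm I(Q_f)$ as quotients of $\Gamma$: there is an isomorphism of representations of $G$ $$Q\;\xrightarrow{\ \sim\ }\;\mathrm I(Q_f)$$ whose composition with the quotient map $\Gamma\to Q$ is the map $\Gamma=\mathrm I(\Gamma_f)\to\mathrm I(Q_f)$ obtained by applying $\mathrm I$ to the quotient map $\Gamma_f\to Q_f$. -/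

import Mathlib

open scoped ValuativeRel

noncomputable section

namespace ParahoricGen

/-! ### Induction of representations -/

section Induction

variable {R : Type*} [CommRing R] {H G : Type*} [Group H] [Group G]
variable {V W : Type*} [AddCommGroup V] [Module R V] [AddCommGroup W] [Module R W]

/-- The space of `ind_H^G ρ` for a homomorphism `φ : H →* G` (in practice the inclusion of a
subgroup): functions `f : G → V` with `f (φ h * g) = ρ h (f g)` whose support lies in finitely many
cosets `φ(H) x`. When `H` is an open subgroup of a topological group and `ρ` is smooth this is
compact induction: the cosets `H x` are open, so "compact support modulo `H`" means "supported on
finitely many cosets", and such an `f` is automatically right invariant under an open subgroup. When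
`G` is finite the support condition is void and this is ordinary induction. -/
def cIndV (φ : H →* G) (ρ : Representation R H V) : Submodule R (G → V) where
  carrier := {f | (∀ h g, f (φ h * g) = ρ h (f g)) ∧
    ∃ s : Finset G, ∀ g, f g ≠ 0 → ∃ h, ∃ x ∈ s, g = φ h * x}
  zero_mem' := ⟨by simp, ∅, by simp⟩
  add_mem' := by
    classical
    rintro f₁ f₂ ⟨h₁, s₁, hs₁⟩ ⟨h₂, s₂, hs₂⟩
    refine ⟨fun h g => by simp [h₁, h₂], s₁ ∪ s₂, fun g hg => ?_⟩
    by_cases h0 : f₁ g = 0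
    · have h0' : f₂ g ≠ 0 := fun h' => hg (by simp [h0, h'])
      obtain ⟨h, x, hx, e⟩ := hs₂ g h0'
      exact ⟨h, x, Finset.mem_union_right _ hx, e⟩
    · obtain ⟨h, x, hx, e⟩ := hs₁ g h0
      exact ⟨h, x, Finset.mem_union_left _ hx, e⟩
  smul_mem' := by
    rintro r f ⟨h₁, s₁, hs₁⟩
    refine ⟨fun h g => by simp [h₁], s₁, fun g hg => hs₁ g fun h' => hg (by simp [h'])⟩

/-- The representation `ind_H^G ρ`: `G` acts by right translation, `(g • f) x = f (x * g)`. -/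
def cInd (φ : H →* G) (ρ : Representation R H V) : Representation R G (cIndV φ ρ) where
  toFun g :=
    { toFun := fun f => ⟨fun x => f.1 (x * g), by
        classical
        obtain ⟨h₁, s, hs⟩ := f.2
        refine ⟨fun h x => by simp only [mul_assoc, h₁], s.image (· * g⁻¹), fun x hx => ?_⟩
        obtain ⟨h, y, hy, e⟩ := hs _ hx
        exact ⟨h, y * g⁻¹, Finset.mem_image_of_mem _ hy, by rw [← mul_assoc, ← e]; group⟩⟩
      map_add' := fun _ _ => rfl
      map_smul' := fun _ _ => rfl }
  map_one' := by
    ext f x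
    simp
  map_mul' g₁ g₂ := by
    ext f x
    simp [mul_assoc]

/-- Functoriality of induction: `f ↦ T ∘ f`. -/
def cIndMap (φ : H →* G) {ρ : Representation R H V} {σ : Representation R H W}
    (T : ρ.IntertwiningMap σ) : (cInd φ ρ).IntertwiningMap (cInd φ σ) where
  toFun f := ⟨fun x => T (f.1 x), by
    obtain ⟨h₁, s, hs⟩ := f.2
    refine ⟨fun h x => by simp only [h₁, T.isIntertwining], s,
      fun x hx => hs x fun h' => hx ?_⟩
    simp only [h', map_zero]⟩
  map_add' f₁ f₂ := by
    ext x
    exact map_add T _ _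
  map_smul' r f := by
    ext x
    exact map_smul T _ _
  isIntertwining' g := rfl

/-- The one-dimensional representation attached to a character. -/
def charRep (χ : H →* Rˣ) : Representation R H R where
  toFun h := (χ h : R) • LinearMap.id
  map_one' := by
    ext
    simp
  map_mul' a b := by
    ext
    simp [mul_comm]

/-- The quotient map onto a quotient representation. -/
def quotientMap (ρ : Representation R G V) (N : Submodule R V)
    (hN : ∀ g, N ≤ N.comap (ρ g)) : ρ.IntertwiningMap (ρ.quotient N hN) where
  toLinearMap := N.mkQ
  isIntertwining' _ := rfl

end Induction

/-! ### Annihilators over the group algebra -/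

section GroupAlgebra

variable {R : Type*} [CommRing R] {G : Type*} [Group G]
variable {V W : Type*} [AddCommGroup V] [Module R V] [AddCommGroup W] [Module R W]

/-- The annihilator of a representation in the group algebra. -/
def groupAnn (π : Representation R G W) : Ideal (MonoidAlgebra R G) :=
  RingHom.ker π.asAlgebraHom

/-- `A V`, where `A` is the annihilator of `π` in the group algebra. -/
def groupAnnSpan (π : Representation R G W) (ρ : Representation R G V) : Submodule R V :=
  Submodule.span R {w | ∃ z ∈ groupAnn π, ∃ v, ρ.asAlgebraHom z v = w}

theorem groupAnnSpan_stable (π : Representation R G W) (ρ : Representation R G V) (g : G) :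
    groupAnnSpan π ρ ≤ (groupAnnSpan π ρ).comap (ρ g) := by
  refine Submodule.span_le.2 ?_
  rintro _ ⟨z, hz, v, rfl⟩
  refine Submodule.subset_span ⟨MonoidAlgebra.single g 1 * z, Ideal.mul_mem_left _ _ hz, v, ?_⟩
  simp [map_mul]

end GroupAlgebra

/-! ### The Hecke algebra of a locally profinite group and its action -/

section Hecke

variable {R : Type*} [Field R] {G : Type*} [Group G]
variable {V W : Type*} [AddCommGroup V] [Module R V] [AddCommGroup W] [Module R W]

/-- The elements of `U₀` under which `φ` is right invariant. -/
def rightStab (U₀ : Subgroup G) (φ : G → V) : Subgroup G where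
  carrier := {u | u ∈ U₀ ∧ ∀ g, φ (g * u) = φ g}
  one_mem' := ⟨U₀.one_mem, by simp⟩
  mul_mem' := by
    rintro a b ⟨ha, ha'⟩ ⟨hb, hb'⟩
    exact ⟨U₀.mul_mem ha hb, fun g => by rw [← mul_assoc, hb', ha']⟩
  inv_mem' := by
    rintro a ⟨ha, ha'⟩
    exact ⟨U₀.inv_mem ha, fun g => by rw [← ha' (g * a⁻¹), inv_mul_cancel_right]⟩

/-- The integral `∫_G φ(g) dg` of a locally constant, compactly supported function with values in
an `R`-vector space, for the `R`-valued Haar measure with `μ(U₀) = 1`, where `U₀` is a compact open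
subgroup all of whose open subgroups have index invertible in `R`. With `U ≤ U₀` the open subgroup
under which `φ` is right invariant, `μ(U) = [U₀ : U]⁻¹` and the integral is
`μ(U) * ∑_{x ∈ G/U} φ(x)`. -/
def haarIntegral (R : Type*) [Field R] {V : Type*} [AddCommGroup V] [Module R V]
    (U₀ : Subgroup G) (φ : G → V) : V :=
  (((rightStab U₀ φ).relIndex U₀ : ℕ) : R)⁻¹ •
    ∑ᶠ x : G ⧸ rightStab U₀ φ, φ x.out

theorem haarIntegral_eq (U₀ : Subgroup G) (φ : G → V) {U : Subgroup G}
    (h : rightStab U₀ φ = U) :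
    haarIntegral R U₀ φ = ((U.relIndex U₀ : ℕ) : R)⁻¹ • ∑ᶠ x : G ⧸ U, φ x.out := by
  subst h
  rfl

theorem haarIntegral_translate (U₀ : Subgroup G) (φ : G → V) (a : G) :
    haarIntegral R U₀ (fun g => φ (a * g)) = haarIntegral R U₀ φ := by
  have hU : rightStab U₀ (fun g => φ (a * g)) = rightStab U₀ φ := by
    ext u
    refine and_congr_right fun _ => ⟨fun h g => ?_, fun h g => ?_⟩
    · have := h (a⁻¹ * g)
      simpa [← mul_assoc] using this
    · simp only [← mul_assoc, h]
  rw [haarIntegral_eq U₀ _ hU, haarIntegral_eq U₀ φ rfl]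
  congr 1
  refine finsum_eq_of_bijective (fun x => a • x) (MulAction.bijective a) fun x => ?_
  obtain ⟨u, hu⟩ := QuotientGroup.mk_out_eq_mul (rightStab U₀ φ) (a * x.out)
  have hx : a • x = ((a * x.out : G) : G ⧸ rightStab U₀ φ) := by
    conv_lhs => rw [← QuotientGroup.out_eq' x]
    rfl
  rw [hx, hu, u.2.2]

theorem haarIntegral_map (U₀ : Subgroup G) (φ : G → V) (T : V →ₗ[R] W)
    (hT : Function.Injective T) :
    haarIntegral R U₀ (fun g => T (φ g)) = T (haarIntegral R U₀ φ) := by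
  have hU : rightStab U₀ (fun g => T (φ g)) = rightStab U₀ φ := by
    ext u
    exact and_congr_right fun _ => forall_congr' fun g => hT.eq_iff
  rw [haarIntegral_eq U₀ _ hU, haarIntegral_eq U₀ φ rfl, map_smul]
  congr 1
  exact (T.toAddMonoidHom.map_finsum_of_injective hT _).symm

/-- The underlying space of the global Hecke algebra `H(G)`: locally constant compactly supported
functions `G → R`. -/
def heckeAlgebra (R : Type*) [Field R] (G : Type*) [Group G] [TopologicalSpace G] :
    Submodule R (G → R) where
  carrier := {f | IsLocallyConstant f ∧ HasCompactSupport f}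
  zero_mem' := ⟨IsLocallyConstant.const 0, HasCompactSupport.zero⟩
  add_mem' := fun h₁ h₂ => ⟨h₁.1.add h₂.1, h₁.2.add h₂.2⟩
  smul_mem' := fun r _ h => ⟨h.1.comp (r • ·), h.2.smul_left (f := fun _ => r)⟩

/-- The action of `f ∈ H(G)` on a vector of a smooth representation: `f v = ∫_G f(g) ρ(g) v dg`,
with `μ(U₀) = 1`. -/
def heckeAction (U₀ : Subgroup G) (ρ : Representation R G V) (f : G → R) (v : V) : V :=
  haarIntegral R U₀ (fun g => f g • ρ g v)

theorem heckeAction_translate (U₀ : Subgroup G) (ρ : Representation R G V) (f : G → R) (v : V)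
    (a : G) : heckeAction U₀ ρ (fun g => f (a⁻¹ * g)) v = ρ a (heckeAction U₀ ρ f v) := by
  have hinj : Function.Injective (ρ a) :=
    Function.LeftInverse.injective (g := ρ a⁻¹) fun v => by
      rw [← Module.End.mul_apply, ← map_mul, inv_mul_cancel, map_one, Module.End.one_apply]
  unfold heckeAction
  rw [← haarIntegral_translate U₀ (fun g => f g • ρ g v) a⁻¹, ← haarIntegral_map U₀ _ (ρ a) hinj]
  congr 1
  funext g
  rw [map_smul, ← Module.End.mul_apply, ← map_mul, mul_inv_cancel_left]

variable [TopologicalSpace G]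

/-- The annihilator of a smooth representation in `H(G)`. -/
def heckeAnn (U₀ : Subgroup G) (π : Representation R G W) : Set (G → R) :=
  {f | f ∈ heckeAlgebra R G ∧ ∀ w, heckeAction U₀ π f w = 0}

/-- `A V`, where `A` is the annihilator of `π` in `H(G)`. -/
def heckeAnnSpan (U₀ : Subgroup G) (π : Representation R G W) (ρ : Representation R G V) :
    Submodule R V :=
  Submodule.span R {w | ∃ f ∈ heckeAnn U₀ π, ∃ v, heckeAction U₀ ρ f v = w}

theorem heckeAnnSpan_stable [IsTopologicalGroup G] (U₀ : Subgroup G) (π : Representation R G W)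
    (ρ : Representation R G V) (a : G) :
    heckeAnnSpan U₀ π ρ ≤ (heckeAnnSpan U₀ π ρ).comap (ρ a) := by
  refine Submodule.span_le.2 ?_
  rintro _ ⟨f, ⟨⟨hf₁, hf₂⟩, hf₃⟩, v, rfl⟩
  refine Submodule.subset_span ⟨fun g => f (a⁻¹ * g), ⟨⟨?_, ?_⟩, fun w => ?_⟩, v,
    heckeAction_translate U₀ ρ f v a⟩
  · exact hf₁.comp_continuous (continuous_const_mul a⁻¹)
  · exact hf₂.comp_homeomorph (Homeomorph.mulLeft a⁻¹)
  · rw [heckeAction_translate, hf₃, map_zero]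

end Hecke

/-! ### Standard parabolic subgroups of `GL_n` over a field -/

section Finite

variable {k : Type*} [Field k] {n : ℕ} {α : Type*} [LinearOrder α]

theorem blockTriangular_inv {b : Fin n → α} {g : GL (Fin n) k}
    (hg : (g : Matrix (Fin n) (Fin n) k).BlockTriangular b) :
    ((g⁻¹ : GL (Fin n) k) : Matrix (Fin n) (Fin n) k).BlockTriangular b := by
  have : Invertible (g : Matrix (Fin n) (Fin n) k) := Units.invertible g
  rw [Matrix.coe_units_inv]
  exact Matrix.blockTriangular_inv_of_blockTriangular hg

/-- The subgroup of block upper triangular matrices, for blocks given by a monotone labelling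
`b` of the indices. -/
def parabolic (k : Type*) [Field k] (b : Fin n → α) : Subgroup (GL (Fin n) k) where
  carrier := {g | (g : Matrix (Fin n) (Fin n) k).BlockTriangular b}
  one_mem' := Matrix.blockTriangular_one
  mul_mem' := fun h₁ h₂ => h₁.mul h₂
  inv_mem' := fun h => blockTriangular_inv h

/-- The Borel subgroup of upper triangular matrices. -/
def borel (k : Type*) [Field k] (n : ℕ) : Subgroup (GL (Fin n) k) :=
  parabolic k (id : Fin n → Fin n)

/-- The Levi subgroup of block diagonal matrices. -/
def levi (k : Type*) [Field k] (b : Fin n → α) : Subgroup (GL (Fin n) k) where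
  carrier := {g | ∀ i j, b i ≠ b j → (g : Matrix (Fin n) (Fin n) k) i j = 0}
  one_mem' := fun i j h => Matrix.one_apply_ne fun e => h (e ▸ rfl)
  mul_mem' := by
    intro x y hx hy i j h
    rw [Units.val_mul, Matrix.mul_apply]
    refine Finset.sum_eq_zero fun l _ => ?_
    by_cases hl : b i = b l
    · rw [hy l j (hl ▸ h), mul_zero]
    · rw [hx i l hl, zero_mul]
  inv_mem' := by
    intro x hx i j h
    rcases lt_or_gt_of_ne h with h | h
    · exact blockTriangular_inv (b := fun i => OrderDual.toDual (b i)) (g := x)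
        (fun i j hij => hx i j (ne_of_lt hij)) h
    · exact blockTriangular_inv (b := b) (g := x) (fun i j hij => hx i j (ne_of_gt hij)) h

/-- The block diagonal part of a matrix. -/
def blockDiagPart (b : Fin n → α) (M : Matrix (Fin n) (Fin n) k) : Matrix (Fin n) (Fin n) k :=
  Matrix.of fun i j => if b i = b j then M i j else 0

theorem blockDiagPart_one (b : Fin n → α) :
    blockDiagPart b (1 : Matrix (Fin n) (Fin n) k) = 1 := by
  ext i j
  by_cases h : i = j
  · subst h
    simp [blockDiagPart]
  · simp [blockDiagPart, Matrix.one_apply_ne h]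

theorem blockDiagPart_mul {b : Fin n → α} {M N : Matrix (Fin n) (Fin n) k}
    (hM : M.BlockTriangular b) (hN : N.BlockTriangular b) :
    blockDiagPart b (M * N) = blockDiagPart b M * blockDiagPart b N := by
  ext i j
  simp only [blockDiagPart, Matrix.of_apply, Matrix.mul_apply]
  split_ifs with h
  · refine Finset.sum_congr rfl fun l _ => ?_
    rcases lt_trichotomy (b i) (b l) with hl | hl | hl
    · rw [hN (h ▸ hl : b j < b l)]
      simp [hl.ne]
    · simp [hl, hl ▸ h]
    · rw [hM hl]
      simp [hl.ne']
  · refine (Finset.sum_eq_zero fun l _ => ?_).symm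
    by_cases hl : b i = b l
    · rw [if_neg (hl ▸ h : ¬ b l = b j), mul_zero]
    · rw [if_neg hl, zero_mul]

/-- The projection of a standard parabolic subgroup onto its Levi subgroup, with kernel the
unipotent radical. -/
def leviProj (k : Type*) [Field k] (b : Fin n → α) : parabolic k b →* levi k b where
  toFun g := ⟨⟨blockDiagPart b g.1, blockDiagPart b (g⁻¹).1, by
      rw [← blockDiagPart_mul g.2 (g⁻¹).2, ← blockDiagPart_one b, ← Units.val_mul]
      simp, by
      rw [← blockDiagPart_mul (g⁻¹).2 g.2, ← blockDiagPart_one b, ← Units.val_mul]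
      simp⟩, fun i j h => if_neg h⟩
  map_one' := by
    ext : 2
    exact blockDiagPart_one b
  map_mul' x y := by
    ext : 2
    exact blockDiagPart_mul x.2 y.2

theorem diag_mul {M N : Matrix (Fin n) (Fin n) k} (hM : M.BlockTriangular id)
    (hN : N.BlockTriangular id) (i : Fin n) : (M * N) i i = M i i * N i i := by
  rw [Matrix.mul_apply]
  refine Finset.sum_eq_single i (fun l _ hl => ?_) (by simp)
  rcases lt_or_gt_of_ne hl with h | h
  · rw [hM h, zero_mul]
  · rw [hN h, mul_zero]

/-- The group of blockwise unipotent upper triangular matrices, inside the Levi subgroup. -/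
def leviUnip (k : Type*) [Field k] (b : Fin n → α) : Subgroup (levi k b) where
  carrier := {u | (u.1 : Matrix (Fin n) (Fin n) k).BlockTriangular id ∧
    ∀ i, (u.1 : Matrix (Fin n) (Fin n) k) i i = 1}
  one_mem' := ⟨Matrix.blockTriangular_one, fun i => Matrix.one_apply_eq i⟩
  mul_mem' := by
    rintro x y ⟨hx, hx'⟩ ⟨hy, hy'⟩
    exact ⟨hx.mul hy, fun i => by
      rw [Subgroup.coe_mul, Units.val_mul, diag_mul hx hy, hx', hy', mul_one]⟩
  inv_mem' := by
    rintro x ⟨hx, hx'⟩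
    refine ⟨blockTriangular_inv hx, fun i => ?_⟩
    have h := diag_mul hx (blockTriangular_inv hx) i
    rw [hx', one_mul, ← Units.val_mul, mul_inv_cancel, Units.val_one, Matrix.one_apply_eq] at h
    exact h.symm

/-! ### The representations of the finite group -/

variable (R : Type*) [Field R] (k) (n)

/-- The generic characters of the group `U_c` of blockwise unipotent matrices, for the block
decomposition given by a composition `c` of `n`: nontrivial on every simple root group (entry
`(i, i + 1)` inside a block), trivial on every other positive root group (entry `(i, j)` inside a
block, `j > i + 1`). -/
def genericChars {n : ℕ} (c : Composition n) : Set (leviUnip k c.index →* Rˣ) :=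
  {χ | ∀ i j : Fin n, i < j → c.index i = c.index j →
    ((i : ℕ) + 1 = j → ∃ (u : leviUnip k c.index) (t : k),
      (u.1.1 : Matrix (Fin n) (Fin n) k) = Matrix.transvection i j t ∧ χ u ≠ 1) ∧
    ((i : ℕ) + 1 ≠ j → ∀ (u : leviUnip k c.index) (t : k),
      (u.1.1 : Matrix (Fin n) (Fin n) k) = Matrix.transvection i j t → χ u = 1)}

/-- `P_f`, the induction of the trivial representation from the Borel subgroup. -/
def finP : Representation R (GL (Fin n) k)
    (cIndV (borel k n).subtype (Representation.trivial R (borel k n) R)) :=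
  cInd (borel k n).subtype (Representation.trivial R (borel k n) R)

/-- The Gelfand-Graev representation `ind_{U_c}^{M_c} χ` of the Levi subgroup, inflated to the
standard parabolic subgroup. -/
def inflGelfandGraev {R : Type*} [Field R] {k : Type*} [Field k] {n : ℕ} (c : Composition n) (χ : leviUnip k c.index →* Rˣ) :
    Representation R (parabolic k c.index) (cIndV (leviUnip k c.index).subtype (charRep χ)) :=
  (cInd (leviUnip k c.index).subtype (charRep χ)).comp (leviProj k c.index)

/-- The index set of the summands of `Γ_f`: pairs of a standard parabolic subgroup, given by a
composition of `n`, and a generic character. -/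
abbrev GammaIndex : Type _ := Σ c : Composition n, genericChars k R c

/-- The space of the summand of `Γ_f` with index `i`. -/
def GammaSummand (i : GammaIndex k n R) : Type _ :=
  cIndV (parabolic k i.1.index).subtype (inflGelfandGraev i.1 i.2.1)

instance (i : GammaIndex k n R) : AddCommGroup (GammaSummand k n R i) :=
  inferInstanceAs
    (AddCommGroup (cIndV (parabolic k i.1.index).subtype (inflGelfandGraev i.1 i.2.1)))

instance (i : GammaIndex k n R) : Module R (GammaSummand k n R i) :=
  inferInstanceAs
    (Module R (cIndV (parabolic k i.1.index).subtype (inflGelfandGraev i.1 i.2.1)))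

/-- The summand `ind_{P_c}^{G_f} infl_{M_c}^{P_c} ind_{U_c}^{M_c} χ` of `Γ_f`. -/
def gammaSummand (i : GammaIndex k n R) :
    Representation R (GL (Fin n) k) (GammaSummand k n R i) :=
  cInd (parabolic k i.1.index).subtype (inflGelfandGraev i.1 i.2.1)

/-- The space of `Γ_f`. -/
def FinGammaV : Type _ := DirectSum (GammaIndex k n R) (GammaSummand k n R)

instance : AddCommGroup (FinGammaV k n R) :=
  inferInstanceAs (AddCommGroup (DirectSum (GammaIndex k n R) (GammaSummand k n R)))

instance : Module R (FinGammaV k n R) :=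
  inferInstanceAs (Module R (DirectSum (GammaIndex k n R) (GammaSummand k n R)))

/-- `Γ_f`, the direct sum over standard parabolic subgroups `P_c` and generic characters `χ` of
`ind_{P_c}^{G_f} infl_{M_c}^{P_c} ind_{U_c}^{M_c} χ`. -/
def finGamma : Representation R (GL (Fin n) k) (FinGammaV k n R) :=
  Representation.directSum (gammaSummand k n R)

/-- The subspace `I_f Γ_f`, with `I_f` the annihilator of `P_f` in the group algebra. -/
def finAnnGamma : Submodule R (FinGammaV k n R) :=
  groupAnnSpan (finP k n R) (finGamma k n R)

/-- `Q_f = Γ_f / I_f Γ_f`. -/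
def finQ : Representation R (GL (Fin n) k) (FinGammaV k n R ⧸ finAnnGamma k n R) :=
  (finGamma k n R).quotient (finAnnGamma k n R) (groupAnnSpan_stable _ _)

/-- The quotient map `Γ_f → Q_f`. -/
def finQuotientMap : (finGamma k n R).IntertwiningMap (finQ k n R) :=
  quotientMap (finGamma k n R) (finAnnGamma k n R) (groupAnnSpan_stable _ _)

end Finite

/-! ### The representations of the `p`-adic group -/

section Padic

variable (F : Type*) [Field F] [ValuativeRel F] (n : ℕ)

/-- A named form of an existing instance; it keeps the terms for the residue field small. -/
instance isLocalRingIntegers (F : Type*) [Field F] [ValuativeRel F] : IsLocalRing 𝒪[F] :=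
  inferInstance

/-- `GL_n` of a field (the ring structure is always the one underlying the field). -/
abbrev FinGL (k : Type*) [Field k] (n : ℕ) : Type _ := GL (Fin n) k

/-- The inclusion of `K = GL_n(𝒪)` into `G = GL_n(F)`. -/
def inclK : GL (Fin n) 𝒪[F] →* GL (Fin n) F :=
  Matrix.GeneralLinearGroup.map (algebraMap 𝒪[F] F)

/-- The reduction map from `K = GL_n(𝒪)` to `G_f = GL_n(k)`. -/
def redK : GL (Fin n) 𝒪[F] →* FinGL 𝓀[F] n :=
  Matrix.GeneralLinearGroup.map (IsLocalRing.residue 𝒪[F])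

/-- The pro-`p` radical `K¹ = 1 + ϖ M_n(𝒪)` of `K`, as a subgroup of `G`. -/
def proRadical : Subgroup (GL (Fin n) F) := (redK F n).ker.map (inclK F n)

/-- The Iwahori subgroup: the preimage in `K` of the Borel subgroup of `G_f`. -/
def iwahori : Subgroup (GL (Fin n) F) := ((borel 𝓀[F] n).comap (redK F n)).map (inclK F n)

variable {F n} {R : Type*} [Field R]
variable {V W : Type*} [AddCommGroup V] [Module R V] [AddCommGroup W] [Module R W]

/-- Inflation along `K → G_f`. -/
def inflK (ρ : Representation R (FinGL 𝓀[F] n) V) : Representation R (GL (Fin n) 𝒪[F]) V :=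
  ρ.comp (redK F n)

/-- The space of the parahoric induction of `ρ`. -/
abbrev ParahoricIndV (ρ : Representation R (FinGL 𝓀[F] n) V) : Submodule R (GL (Fin n) F → V) :=
  cIndV (inclK F n) (inflK ρ)

/-- Parahoric induction `ind_K^G infl_{G_f}^K ρ`. -/
def parahoricInd (ρ : Representation R (FinGL 𝓀[F] n) V) :
    Representation R (GL (Fin n) F) (ParahoricIndV ρ) :=
  cInd (inclK F n) (inflK ρ)

/-- Parahoric induction of a morphism of representations of `G_f`. -/
def parahoricIndMap {ρ : Representation R (FinGL 𝓀[F] n) V}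
    {σ : Representation R (FinGL 𝓀[F] n) W} (T : ρ.IntertwiningMap σ) :
    (parahoricInd ρ).IntertwiningMap (parahoricInd σ) :=
  cIndMap (inclK F n) (ρ := inflK ρ) (σ := inflK σ)
    ⟨T.toLinearMap, fun g => T.isIntertwining' (redK F n g)⟩

variable (F n R)

/-- `P = ind_I^G 1`, for the Iwahori subgroup `I`. -/
def padicP : Representation R (GL (Fin n) F)
    (cIndV (iwahori F n).subtype (Representation.trivial R (iwahori F n) R)) :=
  cInd (iwahori F n).subtype (Representation.trivial R (iwahori F n) R)

/-- The space of `Γ`. -/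
abbrev PadicGammaV : Type _ :=
  ParahoricIndV (finGamma 𝓀[F] n R)

/-- `Γ`, the parahoric induction of `Γ_f`. -/
def padicGamma : Representation R (GL (Fin n) F) (PadicGammaV F n R) :=
  parahoricInd (finGamma 𝓀[F] n R)

variable [TopologicalSpace F]

/-- The subspace `I Γ`, with `I` the annihilator of `P` in the global Hecke algebra of `G`, where
the Haar measure gives `K¹` volume `1`. -/
def padicAnnGamma : Submodule R (PadicGammaV F n R) :=
  heckeAnnSpan (proRadical F n) (padicP F n R) (padicGamma F n R)

variable [IsNonarchimedeanLocalField F]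

/-- `Q = Γ / I Γ`. -/
def padicQ : Representation R (GL (Fin n) F) (PadicGammaV F n R ⧸ padicAnnGamma F n R) :=
  (padicGamma F n R).quotient (padicAnnGamma F n R) (heckeAnnSpan_stable _ _ _)

/-- The quotient map `Γ → Q`. -/
def padicQuotientMap : (padicGamma F n R).IntertwiningMap (padicQ F n R) :=
  quotientMap (padicGamma F n R) (padicAnnGamma F n R) (heckeAnnSpan_stable _ _ _)

end Padic

end ParahoricGen

end

/-!
Write `I_f` and `𝓘` for the annihilators of `P_f` and `P`. Both quotients of `Γ = I(Γ_f)` agree once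
`𝓘 Γ` is shown to consist of the functions in `Γ` with values in `I_f Γ_f`.

The data from which `Γ_f` is induced live on `p`-groups, whose orders are invertible in `R`, so
Higman's criterion makes `Γ_f` projective over `R[G_f]`. Hence `I_f Γ_f` is the common kernel of all
maps `Γ_f → P_f`. Such a map induces `Γ → I(P_f)`, and induction in stages embeds `I(P_f)` in `P`.
Therefore `𝓘` kills `I(P_f)`, and `𝓘 Γ` takes values in `I_f Γ_f`.

Conversely, `z ∈ I_f` inflates to a Hecke operator supported on `K`, and it has to be seen that this
operator kills all of `P`, not only `I(P_f)`. It factors through the `K¹`-invariants of `P`. For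
`y ∈ G`, the double coset decomposition of `G` into `I w K` with `w` monomial shows that the image
of `K ∩ y⁻¹ I y` in `G_f` contains a conjugate of `B_f`; so the restriction of a `K¹`-invariant
element of `P` to `y K` is a translate of an element of `P_f`, and is killed by `z`.
-/

noncomputable section

namespace ParahoricGen

section Projective

theorem mem_annihilator_smul_top {A M N : Type*} [Ring A] [AddCommGroup M] [Module A M]
    [AddCommGroup N] [Module A N] [Module.Projective A M] {w : M}
    (hw : ∀ T : M →ₗ[A] N, T w = 0) : w ∈ Module.annihilator A N • (⊤ : Submodule A M) := by
  obtain ⟨s, hs⟩ := Module.projective_def.1 ‹Module.Projective A M›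
  rw [← hs w, Finsupp.linearCombination_apply]
  refine Submodule.sum_mem _ fun v _ => Submodule.smul_mem_smul ?_ Submodule.mem_top
  exact Module.mem_annihilator.2 fun x =>
    hw (LinearMap.toSpanSingleton A N x ∘ₗ Finsupp.lapply v ∘ₗ s)

variable {R : Type*} [CommRing R] {G : Type*} [Group G]
variable {V W : Type*} [AddCommGroup V] [Module R V] [AddCommGroup W] [Module R W]

theorem mem_groupAnnSpan_of_forall_intertwiningMap {π : Representation R G W}
    {ρ : Representation R G V} [Module.Projective (MonoidAlgebra R G) ρ.asModule] {w : V}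
    (hw : ∀ T : ρ.IntertwiningMap π, T w = 0) : w ∈ groupAnnSpan π ρ := by
  have hmem := mem_annihilator_smul_top (N := π.asModule) (w := ρ.asModuleEquiv.symm w) fun T =>
    π.asModuleEquiv.injective <|
      (hw ((Representation.IntertwiningMap.equivLinearMapAsModule ρ π).symm T)).trans
        (map_zero _).symm
  refine Submodule.smul_induction_on (p := fun x => ρ.asModuleEquiv x ∈ groupAnnSpan π ρ) hmem
    (fun z hz v _ => ?_) fun x y hx hy => ?_
  · rw [Representation.asModuleEquiv_map_smul]
    refine Submodule.subset_span ⟨z, RingHom.mem_ker.2 (LinearMap.ext fun x => ?_), _, rfl⟩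
    have hzx := congrArg π.asModuleEquiv
      (Module.mem_annihilator.1 hz (π.asModuleEquiv.symm x))
    simpa only [Representation.asModuleEquiv_map_smul, map_zero, LinearEquiv.apply_symm_apply,
      LinearMap.zero_apply] using hzx
  · rw [map_add]
    exact add_mem hx hy

end Projective

section Induction

variable {R : Type*} [CommRing R] {G : Type*} [Group G]
variable {V W : Type*} [AddCommGroup V] [Module R V] [AddCommGroup W] [Module R W]

theorem exists_quotient_equiv {ρ : Representation R G V} {σ : Representation R G W}
    (T : ρ.IntertwiningMap σ) (hT : Function.Surjective T) {N : Submodule R V}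
    (hN : ∀ g, N ≤ N.comap (ρ g)) (hker : ∀ v, v ∈ N ↔ T v = 0) :
    ∃ e : (ρ.quotient N hN).Equiv σ, ∀ v, e (quotientMap ρ N hN v) = T v := by
  obtain rfl : N = LinearMap.ker T.toLinearMap := Submodule.ext hker
  refine ⟨.mk (T.toLinearMap.quotKerEquivOfSurjective hT) fun g => ?_, fun v => rfl⟩
  exact Submodule.linearMap_qext _ (LinearMap.ext fun v => T.isIntertwining _ _ g v)

variable {H : Type*} [Group H] {φ : H →* G} {ρ : Representation R H V} {σ : Representation R H W}

/-- The embedding of `ρ` in `ind_H^G ρ` as the functions supported on `φ(H)`; such a function is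
determined by its value at `1`. -/
def cIndSingle (hφ : Function.Injective φ) (ρ : Representation R H V) : V →ₗ[R] cIndV φ ρ where
  toFun v := ⟨Function.extend φ (fun h => ρ h v) 0, by
    refine ⟨fun h g => ?_, {1}, fun g hg => ?_⟩
    · by_cases hg : ∃ a, φ a = g
      · obtain ⟨a, rfl⟩ := hg
        rw [← map_mul, hφ.extend_apply, hφ.extend_apply, map_mul, Module.End.mul_apply]
      · have hg' : ¬ ∃ a, φ a = φ h * g := fun ⟨a, ha⟩ =>
          hg ⟨h⁻¹ * a, by rw [map_mul, ha, map_inv, inv_mul_cancel_left]⟩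
        rw [Function.extend_apply' _ _ _ hg, Function.extend_apply' _ _ _ hg', Pi.zero_apply,
          Pi.zero_apply, map_zero]
    · obtain ⟨a, rfl⟩ : ∃ a, φ a = g :=
        not_imp_comm.1 (Function.extend_apply' _ _ _) hg
      exact ⟨a, 1, Finset.mem_singleton_self 1, (mul_one _).symm⟩⟩
  map_add' v w := Subtype.ext <| by
    simp only [map_add]
    exact (congrArg _ (add_zero 0).symm).trans (Function.extend_add φ _ _ 0 0)
  map_smul' r v := Subtype.ext <| by
    simp only [map_smul]
    exact (congrArg _ (smul_zero r).symm).trans (Function.extend_smul r φ _ 0)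

theorem cIndSingle_apply_map (hφ : Function.Injective φ) (v : V) (h : H) :
    (cIndSingle hφ ρ v).1 (φ h) = ρ h v :=
  hφ.extend_apply (fun h => ρ h v) 0 h

theorem cIndSingle_apply_of_notMem_range (hφ : Function.Injective φ) (v : V) {g : G}
    (hg : g ∉ φ.range) : (cIndSingle hφ ρ v).1 g = 0 :=
  Function.extend_apply' (fun h => ρ h v) (0 : G → V) g hg

theorem sub_cInd_inv_cIndSingle_apply (hφ : Function.Injective φ) (f : cIndV φ ρ) (x g : G) :
    (f - cInd φ ρ x⁻¹ (cIndSingle hφ ρ (f.1 x))).1 g = 0 ∧ g * x⁻¹ ∈ φ.range ∨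
      (f - cInd φ ρ x⁻¹ (cIndSingle hφ ρ (f.1 x))).1 g = f.1 g ∧ g * x⁻¹ ∉ φ.range := by
  change f.1 g - (cIndSingle hφ ρ (f.1 x)).1 (g * x⁻¹) = 0 ∧ _ ∨
    f.1 g - (cIndSingle hφ ρ (f.1 x)).1 (g * x⁻¹) = f.1 g ∧ _
  by_cases hg : g * x⁻¹ ∈ φ.range
  · obtain ⟨h, hh⟩ := id hg
    refine .inl ⟨sub_eq_zero.2 ?_, hg⟩
    rw [← hh, cIndSingle_apply_map, ← f.2.1, hh, inv_mul_cancel_right]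
  · exact .inr ⟨by rw [cIndSingle_apply_of_notMem_range hφ _ hg, sub_zero], hg⟩

theorem mem_of_forall_cIndSingle_mem (hφ : Function.Injective φ) {S : Submodule R (cIndV φ ρ)}
    (hS : ∀ g, S ≤ S.comap (cInd φ ρ g)) {N : Submodule R V}
    (hN : ∀ v ∈ N, cIndSingle hφ ρ v ∈ S) {f : cIndV φ ρ} (hf : ∀ g, f.1 g ∈ N) : f ∈ S := by
  classical
  obtain ⟨s, hs⟩ := f.2.2
  induction s using Finset.induction_on generalizing f with
  | empty =>
    convert S.zero_mem
    ext g
    by_contra hg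
    obtain ⟨_, _, hx, _⟩ := hs g hg
    exact Finset.notMem_empty _ hx
  | insert x s _ ih =>
    refine (Submodule.sub_mem_iff_left S (hS x⁻¹ (hN _ (hf x)))).1 (ih (fun g => ?_) fun g hg => ?_)
    · rcases sub_cInd_inv_cIndSingle_apply hφ f x g with ⟨e, _⟩ | ⟨e, _⟩
      · exact e ▸ N.zero_mem
      · exact e ▸ hf g
    · rcases sub_cInd_inv_cIndSingle_apply hφ f x g with ⟨e, _⟩ | ⟨e, hgx⟩
      · exact absurd e hg
      · obtain ⟨h, y, hy, rfl⟩ := hs g (e ▸ hg)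
        rcases Finset.mem_insert.1 hy with rfl | hy
        · exact absurd ⟨h, (mul_inv_cancel_right _ _).symm⟩ hgx
        · exact ⟨h, y, hy, rfl⟩

theorem cIndMap_surjective (hφ : Function.Injective φ) {T : ρ.IntertwiningMap σ}
    (hT : Function.Surjective T) : Function.Surjective (cIndMap φ T) := by
  intro f
  refine mem_of_forall_cIndSingle_mem (S := LinearMap.range (cIndMap φ T).toLinearMap)
    (N := ⊤) hφ ?_ (fun w _ => ?_) fun _ => Submodule.mem_top
  · rintro g _ ⟨f, rfl⟩
    exact ⟨cInd φ ρ g f, (cIndMap φ T).isIntertwining _ _ g f⟩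
  · obtain ⟨v, rfl⟩ := hT w
    refine ⟨cIndSingle hφ ρ v, ?_⟩
    ext g
    by_cases hg : g ∈ φ.range
    · obtain ⟨h, rfl⟩ := hg
      rw [cIndSingle_apply_map, ← T.isIntertwining, ← cIndSingle_apply_map hφ]
      rfl
    · rw [cIndSingle_apply_of_notMem_range hφ _ hg]
      exact (congrArg T (cIndSingle_apply_of_notMem_range hφ v hg)).trans (map_zero T)

section Stages

variable {M U : Type*} [Group M] [Group U] {q : H →* M} {ψ : U →* M} {τ : Representation R U W}

variable (φ q ψ τ) in
/-- The passage from `ind_H^G infl_M^H ind_U^M τ` to functions on `G` underlying induction in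
stages. -/
def evalAtOne : cIndV φ ((cInd ψ τ).comp q) →ₗ[R] G → W where
  toFun f g := (f.1 g).1 1
  map_add' _ _ := rfl
  map_smul' _ _ := rfl

theorem evalAtOne_map_mul (f : cIndV φ ((cInd ψ τ).comp q)) (h : H) (g : G) :
    evalAtOne φ q ψ τ f (φ h * g) = (f.1 g).1 (q h) := by
  change (f.1 (φ h * g)).1 1 = _
  rw [f.2.1]
  exact congrArg (f.1 g).1 (one_mul _)

theorem evalAtOne_map_mul_of_eq (f : cIndV φ ((cInd ψ τ).comp q)) {h : H} {u : U}
    (hu : q h = ψ u) (g : G) :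
    evalAtOne φ q ψ τ f (φ h * g) = τ u (evalAtOne φ q ψ τ f g) := by
  rw [evalAtOne_map_mul, hu, ← mul_one (ψ u), (f.1 g).2.1]
  rfl

theorem evalAtOne_injective (hq : Function.Surjective q) :
    Function.Injective (evalAtOne φ q ψ τ) := by
  intro f₁ f₂ h
  ext g m
  obtain ⟨a, rfl⟩ := hq m
  rw [← evalAtOne_map_mul, h, evalAtOne_map_mul]

end Stages

end Induction

section Haar

variable {R : Type*} [Field R] {G : Type*} [Group G]
variable {V W : Type*} [AddCommGroup V] [Module R V] [AddCommGroup W] [Module R W]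

theorem apply_quotient_out {X : Type*} {U : Subgroup G} {ψ : G → X}
    (hψ : ∀ u ∈ U, ∀ g, ψ (g * u) = ψ g) (g : G) : ψ (g : G ⧸ U).out = ψ g := by
  obtain ⟨u, hu⟩ := QuotientGroup.mk_out_eq_mul U g
  rw [hu, hψ u u.2]

theorem finite_support_quotient_out {U : Subgroup G} {ψ : G → V}
    (hfin : ((↑) '' Function.support ψ : Set (G ⧸ U)).Finite) :
    (Function.support fun x : G ⧸ U => ψ x.out).Finite :=
  hfin.subset fun x hx => ⟨x.out, hx, QuotientGroup.out_eq' x⟩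

theorem finsum_quotient_eq_relIndex_smul {U S : Subgroup G} (hUS : U ≤ S)
    (hidx : U.relIndex S ≠ 0) {ψ : G → V} (hψ : ∀ s ∈ S, ∀ g, ψ (g * s) = ψ g)
    (hfin : ((↑) '' Function.support ψ : Set (G ⧸ U)).Finite) :
    ∑ᶠ x : G ⧸ U, ψ x.out = U.relIndex S • ∑ᶠ x : G ⧸ S, ψ x.out := by
  have : Finite (S ⧸ U.subgroupOf S) := Nat.finite_of_card_ne_zero hidx
  have := Fintype.ofFinite (S ⧸ U.subgroupOf S)
  let E := Subgroup.quotientEquivProdOfLE hUS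
  have hE (x : G ⧸ U) : ψ x.out = ψ (E x).1.out := by
    obtain ⟨g, rfl⟩ := QuotientGroup.mk_surjective x
    rw [apply_quotient_out fun u hu => hψ u (hUS hu)]
    exact (apply_quotient_out hψ g).symm
  have hprod : (Function.support fun y : (G ⧸ S) × (S ⧸ U.subgroupOf S) => ψ y.1.out).Finite := by
    refine ((finite_support_quotient_out hfin).image E).subset fun y hy =>
      ⟨E.symm y, ?_, E.apply_symm_apply y⟩
    rwa [Function.mem_support, hE, E.apply_symm_apply]
  have hbase : (Function.support fun x : G ⧸ S => ψ x.out).Finite :=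
    (hprod.image Prod.fst).subset fun x hx => ⟨(x, ((1 : S) : S ⧸ U.subgroupOf S)), hx, rfl⟩
  calc ∑ᶠ x : G ⧸ U, ψ x.out
      = ∑ᶠ y : (G ⧸ S) × (S ⧸ U.subgroupOf S), ψ y.1.out :=
        finsum_eq_of_bijective E E.bijective hE
    _ = ∑ᶠ x : G ⧸ S, ∑ᶠ _ : S ⧸ U.subgroupOf S, ψ x.out := finsum_curry _ hprod
    _ = ∑ᶠ x : G ⧸ S, U.relIndex S • ψ x.out := finsum_congr fun x => by
        rw [finsum_eq_sum_of_fintype, Finset.sum_const, Finset.card_univ,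
          ← Nat.card_eq_fintype_card]
        rfl
    _ = U.relIndex S • ∑ᶠ x : G ⧸ S, ψ x.out := (smul_finsum' _ hbase).symm

variable (R) in
/-- The integral of `ψ` for the Haar measure with `μ(U₀) = 1` is a finite sum over cosets of the
subgroup `U`, which has finite index in `U₀`, invertible in `R`. -/
structure IntegrableAtLevel (U₀ U : Subgroup G) (ψ : G → V) : Prop where
  le : U ≤ U₀
  relIndex_ne_zero : (U.relIndex U₀ : R) ≠ 0
  mul_right : ∀ u ∈ U, ∀ g, ψ (g * u) = ψ g
  finite_support : ((↑) '' Function.support ψ : Set (G ⧸ U)).Finite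

variable {U₀ U : Subgroup G} {ψ : G → V}

theorem IntegrableAtLevel.map (h : IntegrableAtLevel R U₀ U ψ) (T : V →ₗ[R] W) :
    IntegrableAtLevel R U₀ U fun g => T (ψ g) where
  le := h.le
  relIndex_ne_zero := h.relIndex_ne_zero
  mul_right u hu g := congrArg T (h.mul_right u hu g)
  finite_support := h.finite_support.subset <|
    Set.image_mono fun g hg h0 => hg (by simp only [h0, map_zero])

theorem IntegrableAtLevel.haarIntegral_eq (h : IntegrableAtLevel R U₀ U ψ) :
    haarIntegral R U₀ ψ = (U.relIndex U₀ : R)⁻¹ • ∑ᶠ x : G ⧸ U, ψ x.out := by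
  have hUS : U ≤ rightStab U₀ ψ := fun u hu => ⟨h.le hu, h.mul_right u hu⟩
  have hmul := Subgroup.relIndex_mul_relIndex U (rightStab U₀ ψ) U₀ hUS fun u hu => hu.1
  have hidx := h.relIndex_ne_zero
  rw [← hmul, Nat.cast_mul] at hidx
  rw [finsum_quotient_eq_relIndex_smul hUS
    (fun h0 => left_ne_zero_of_mul hidx (by rw [h0, Nat.cast_zero])) (fun s hs => hs.2)
    h.finite_support, ← Nat.cast_smul_eq_nsmul R, smul_smul, ← hmul, Nat.cast_mul, mul_inv_rev,
    inv_mul_cancel_right₀ (left_ne_zero_of_mul hidx)]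
  rfl

theorem IntegrableAtLevel.haarIntegral_map (h : IntegrableAtLevel R U₀ U ψ) (T : V →ₗ[R] W) :
    haarIntegral R U₀ (fun g => T (ψ g)) = T (haarIntegral R U₀ ψ) := by
  rw [(h.map T).haarIntegral_eq, h.haarIntegral_eq, map_smul]
  exact congrArg _ (map_finsum T (finite_support_quotient_out h.finite_support)).symm

end Haar

section Topological

open Filter Topology

variable {R : Type*} [Field R] {G : Type*} [Group G] [TopologicalSpace G]
variable {V W : Type*} [AddCommGroup V] [Module R V] [AddCommGroup W] [Module R W]

variable (R) in
/-- There is an `R`-valued Haar measure with `μ(U₀) = 1`: the identity has arbitrarily small open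
subgroups whose index in `U₀` is finite and invertible in `R`. -/
def AdmitsHaarMeasure (U₀ : Subgroup G) : Prop :=
  ∀ N ∈ 𝓝 (1 : G), ∃ U ≤ U₀, IsOpen (U : Set G) ∧ (U : Set G) ⊆ N ∧ (U.relIndex U₀ : R) ≠ 0

theorem AdmitsHaarMeasure.isOpen [ContinuousMul G] {U₀ : Subgroup G}
    (hU₀ : AdmitsHaarMeasure R U₀) : IsOpen (U₀ : Set G) :=
  have ⟨_, hle, hopen, _⟩ := hU₀ Set.univ univ_mem
  Subgroup.isOpen_mono hle hopen

/-- A compactly supported function on `G` which is right invariant under a neighbourhood of `1`. -/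
structure IsTestFunction (ψ : G → V) : Prop where
  eventually_mul_right : ∀ᶠ u in 𝓝 1, ∀ g, ψ (g * u) = ψ g
  hasCompactSupport : HasCompactSupport ψ

/-- A vector of a representation fixed by a neighbourhood of `1`. -/
def IsSmoothVector (ρ : Representation R G V) (v : V) : Prop :=
  ∀ᶠ u in 𝓝 1, ρ u v = v

theorem IsSmoothVector.map {ρ : Representation R G V} {σ : Representation R G W} {v : V}
    (hv : IsSmoothVector ρ v) (T : ρ.IntertwiningMap σ) : IsSmoothVector σ (T v) :=
  Filter.Eventually.mono hv fun u hu => by rw [← T.isIntertwining, hu]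

theorem IsTestFunction.smul {f : G → R} (hf : IsTestFunction f) {ρ : Representation R G V} {v : V}
    (hv : IsSmoothVector ρ v) : IsTestFunction fun g => f g • ρ g v where
  eventually_mul_right := by
    filter_upwards [hf.eventually_mul_right, hv] with u hfu hvu g
    rw [hfu, map_mul, Module.End.mul_apply, hvu]
  hasCompactSupport := hf.hasCompactSupport.smul_right

theorem IsTestFunction.prodMk {ψ ψ' : G → V} (hψ : IsTestFunction ψ) (hψ' : IsTestFunction ψ') :
    IsTestFunction fun g => (ψ g, ψ' g) where
  eventually_mul_right := by
    filter_upwards [hψ.eventually_mul_right, hψ'.eventually_mul_right] with u h h' g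
    rw [h, h']
  hasCompactSupport := by
    refine (hψ.hasCompactSupport.isCompact.union hψ'.hasCompactSupport.isCompact).of_isClosed_subset
      isClosed_closure (closure_minimal (fun g hg => ?_)
        ((isClosed_tsupport ψ).union (isClosed_tsupport ψ')))
    by_contra h
    obtain ⟨h, h'⟩ := not_or.1 h
    exact hg (Prod.mk_eq_zero.2
      ⟨image_eq_zero_of_notMem_tsupport h, image_eq_zero_of_notMem_tsupport h'⟩)

variable [IsTopologicalGroup G]

theorem isTestFunction_of_mem_heckeAlgebra {f : G → R} (hf : f ∈ heckeAlgebra R G) :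
    IsTestFunction f where
  hasCompactSupport := hf.2
  eventually_mul_right := by
    have hK : ∀ᶠ u in 𝓝 (1 : G), ∀ g ∈ tsupport f, f (g * u) = f g := by
      refine IsCompact.eventually_forall_of_forall_eventually
        (P := fun u g => f (g * u) = f g) hf.2 fun g _ => ?_
      have hmul : Tendsto (fun z : G × G => z.2 * z.1) (𝓝 (1, g)) (𝓝 g) :=
        (continuous_snd.mul continuous_fst).tendsto' _ _ (mul_one g)
      have hnear := (IsLocallyConstant.iff_eventually_eq f).1 hf.1 g
      filter_upwards [hmul.eventually hnear, (continuous_snd.tendsto ((1 : G), g)).eventually hnear]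
        with z h₁ h₂ using h₁.trans h₂.symm
    have hK' := (continuous_inv.tendsto' (1 : G) 1 inv_one).eventually hK
    filter_upwards [hK, hK'] with u hu hu' g
    by_cases hg : g ∈ tsupport f
    · exact hu g hg
    by_cases hgu : g * u ∈ tsupport f
    · simpa only [mul_inv_cancel_right] using (hu' _ hgu).symm
    · rw [image_eq_zero_of_notMem_tsupport hg, image_eq_zero_of_notMem_tsupport hgu]

variable {U₀ : Subgroup G} {ψ ψ' : G → V}

omit [Module R V] in
theorem IsTestFunction.exists_integrableAtLevel (hU₀ : AdmitsHaarMeasure R U₀)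
    (hψ : IsTestFunction ψ) : ∃ U, IntegrableAtLevel R U₀ U ψ := by
  obtain ⟨U, hle, hopen, hmem, hidx⟩ := hU₀ _ hψ.eventually_mul_right
  have := QuotientGroup.discreteTopology hopen
  have hfin : ((↑) '' tsupport ψ : Set (G ⧸ U)).Finite :=
    (hψ.hasCompactSupport.isCompact.image QuotientGroup.continuous_mk).finite_of_discrete
  exact ⟨U, hle, hidx, hmem, hfin.subset (Set.image_mono (subset_tsupport ψ))⟩

theorem IsTestFunction.haarIntegral_map (hU₀ : AdmitsHaarMeasure R U₀) (hψ : IsTestFunction ψ)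
    (T : V →ₗ[R] W) : haarIntegral R U₀ (fun g => T (ψ g)) = T (haarIntegral R U₀ ψ) :=
  have ⟨_, h⟩ := hψ.exists_integrableAtLevel hU₀
  h.haarIntegral_map T

theorem haarIntegral_add (hU₀ : AdmitsHaarMeasure R U₀) (hψ : IsTestFunction ψ)
    (hψ' : IsTestFunction ψ') :
    haarIntegral R U₀ (fun g => ψ g + ψ' g) = haarIntegral R U₀ ψ + haarIntegral R U₀ ψ' := by
  have h := (hψ.prodMk hψ').haarIntegral_map hU₀ (W := V)
  have hadd := h (LinearMap.fst R V V + LinearMap.snd R V V)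
  rw [LinearMap.add_apply, ← h (LinearMap.fst R V V), ← h (LinearMap.snd R V V)] at hadd
  exact hadd

section HeckeAction

variable {f f' : G → R} {ρ : Representation R G V} {σ : Representation R G W} {v : V}

theorem heckeAction_map (hU₀ : AdmitsHaarMeasure R U₀) (hf : IsTestFunction f)
    (hv : IsSmoothVector ρ v) (T : ρ.IntertwiningMap σ) :
    heckeAction U₀ σ f (T v) = T (heckeAction U₀ ρ f v) := by
  simpa only [heckeAction, T.toLinearMap_apply, map_smul, T.isIntertwining] using
    (hf.smul hv).haarIntegral_map hU₀ T.toLinearMap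

theorem heckeAction_smul (hU₀ : AdmitsHaarMeasure R U₀) (hf : IsTestFunction f)
    (hv : IsSmoothVector ρ v) (c : R) :
    heckeAction U₀ ρ (c • f) v = c • heckeAction U₀ ρ f v := by
  simpa only [heckeAction, Pi.smul_apply, smul_assoc, LinearMap.lsmul_apply] using
    (hf.smul hv).haarIntegral_map hU₀ (LinearMap.lsmul R V c)

theorem heckeAction_add (hU₀ : AdmitsHaarMeasure R U₀) (hf : IsTestFunction f)
    (hf' : IsTestFunction f') (hv : IsSmoothVector ρ v) :
    heckeAction U₀ ρ (f + f') v = heckeAction U₀ ρ f v + heckeAction U₀ ρ f' v := by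
  simpa only [heckeAction, Pi.add_apply, add_smul] using
    haarIntegral_add hU₀ (hf.smul hv) (hf'.smul hv)

theorem heckeAction_sum {ι : Type*} (hU₀ : AdmitsHaarMeasure R U₀) (s : Finset ι) {f : ι → G → R}
    (hf : ∀ i, f i ∈ heckeAlgebra R G) (hv : IsSmoothVector ρ v) :
    heckeAction U₀ ρ (∑ i ∈ s, f i) v = ∑ i ∈ s, heckeAction U₀ ρ (f i) v := by
  classical
  induction s using Finset.induction_on with
  | empty =>
    simpa only [Finset.sum_empty, zero_smul] using
      heckeAction_smul hU₀ (isTestFunction_of_mem_heckeAlgebra (zero_mem _)) hv (0 : R)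
  | insert i s hi ih =>
    rw [Finset.sum_insert hi, Finset.sum_insert hi, ← ih]
    exact heckeAction_add hU₀ (isTestFunction_of_mem_heckeAlgebra (hf i))
      (isTestFunction_of_mem_heckeAlgebra (sum_mem fun j _ => hf j)) hv

end HeckeAction

section Idempotent

theorem translate_mem_heckeAlgebra {f : G → R} (hf : f ∈ heckeAlgebra R G) (a : G) :
    (fun g => f (a⁻¹ * g)) ∈ heckeAlgebra R G :=
  ⟨hf.1.comp_continuous (continuous_const_mul a⁻¹),
    hf.2.comp_homeomorph (Homeomorph.mulLeft a⁻¹)⟩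

variable (R U₀) in
/-- The characteristic function of `U₀`, which acts as the projection onto the `U₀`-invariants. -/
def heckeIdempotent : G → R :=
  (U₀ : Set G).indicator 1

theorem heckeIdempotent_mem_heckeAlgebra (hopen : IsOpen (U₀ : Set G))
    (hcompact : IsCompact (U₀ : Set G)) : heckeIdempotent R U₀ ∈ heckeAlgebra R G := by
  have hclosed := Subgroup.isClosed_of_isOpen U₀ hopen
  have hclopen : IsClopen (U₀ : Set G) := ⟨hclosed, hopen⟩
  refine ⟨?_, hcompact.of_isClosed_subset isClosed_closure
    (closure_minimal Set.support_indicator_subset hclosed)⟩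
  rw [heckeIdempotent, ← LocallyConstant.coe_charFn R hclopen]
  exact (LocallyConstant.charFn R hclopen).isLocallyConstant

omit [TopologicalSpace G] [IsTopologicalGroup G]

theorem map_heckeAction_heckeIdempotent (ρ : Representation R G V) (v : V) {u : G} (hu : u ∈ U₀) :
    ρ u (heckeAction U₀ ρ (heckeIdempotent R U₀) v) =
      heckeAction U₀ ρ (heckeIdempotent R U₀) v := by
  rw [← heckeAction_translate]
  exact congrArg (heckeAction U₀ ρ · v) <| funext fun g =>
    Set.indicator_const_eq_indicator_const (U₀.mul_mem_cancel_left (U₀.inv_mem hu))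

theorem heckeAction_heckeIdempotent_of_invariant {ρ : Representation R G V} {v : V}
    (hv : ∀ u ∈ U₀, ρ u v = v) : heckeAction U₀ ρ (heckeIdempotent R U₀) v = v := by
  have hfin (x : G ⧸ U₀) (hx : x ≠ ((1 : G) : G ⧸ U₀)) :
      heckeIdempotent R U₀ x.out • ρ x.out v = 0 := by
    have hmem : x.out ∉ (U₀ : Set G) := fun h => hx <| by
      rw [← QuotientGroup.out_eq' x, QuotientGroup.eq, mul_one]
      exact U₀.inv_mem h
    rw [heckeIdempotent, Set.indicator_of_notMem hmem, zero_smul]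
  have hone : ((1 : G) : G ⧸ U₀).out ∈ (U₀ : Set G) := by
    obtain ⟨u, hu⟩ := QuotientGroup.mk_out_eq_mul U₀ (1 : G)
    rw [hu, one_mul]
    exact u.2
  have hstab : rightStab U₀ (fun g => heckeIdempotent R U₀ g • ρ g v) = U₀ := by
    refine le_antisymm (fun u hu => hu.1) fun u hu => ⟨hu, fun g => ?_⟩
    beta_reduce
    rw [map_mul, Module.End.mul_apply, hv u hu]
    exact congrArg (· • ρ g v) <|
      Set.indicator_const_eq_indicator_const (U₀.mul_mem_cancel_right hu)
  rw [heckeAction, haarIntegral_eq U₀ _ hstab, Subgroup.relIndex_self, Nat.cast_one, inv_one,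
    one_smul, finsum_eq_single _ _ hfin, heckeIdempotent, Set.indicator_of_mem hone, Pi.one_apply,
    one_smul, hv _ hone]

end Idempotent

section CosetSum

variable {ι : Type*} [Fintype ι]

variable (R U₀) in
/-- The linear combination `∑ z i [a i U₀]` of characteristic functions of cosets. -/
def heckeCosetSum (a : ι → G) (z : ι → R) : G → R :=
  ∑ i, z i • fun g => heckeIdempotent R U₀ ((a i)⁻¹ * g)

theorem heckeCosetSum_mem_heckeAlgebra (hopen : IsOpen (U₀ : Set G))
    (hcompact : IsCompact (U₀ : Set G)) (a : ι → G) (z : ι → R) :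
    heckeCosetSum R U₀ a z ∈ heckeAlgebra R G :=
  sum_mem fun i _ => Submodule.smul_mem _ _
    (translate_mem_heckeAlgebra (heckeIdempotent_mem_heckeAlgebra hopen hcompact) (a i))

theorem heckeAction_heckeCosetSum (hU₀ : AdmitsHaarMeasure R U₀)
    (hcompact : IsCompact (U₀ : Set G)) (a : ι → G) (z : ι → R) {ρ : Representation R G V} {v : V}
    (hv : IsSmoothVector ρ v) :
    heckeAction U₀ ρ (heckeCosetSum R U₀ a z) v =
      ∑ i, z i • ρ (a i) (heckeAction U₀ ρ (heckeIdempotent R U₀) v) := by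
  have hmem (i : ι) := translate_mem_heckeAlgebra
    (heckeIdempotent_mem_heckeAlgebra (R := R) hU₀.isOpen hcompact) (a i)
  rw [heckeCosetSum, heckeAction_sum hU₀ _ (fun i => Submodule.smul_mem _ _ (hmem i)) hv]
  refine Finset.sum_congr rfl fun i _ => ?_
  rw [heckeAction_smul hU₀ (isTestFunction_of_mem_heckeAlgebra (hmem i)) hv, heckeAction_translate]

end CosetSum

end Topological

section InflatedInduction

open Topology

variable {R : Type*} [Field R] {G H M : Type*} [Group G] [Group H] [Group M]
variable {V W X : Type*} [AddCommGroup V] [Module R V] [AddCommGroup W] [Module R W]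
variable [AddCommGroup X] [Module R X]
variable {φ : H →* G} {q : H →* M}

theorem asAlgebraHom_apply_eq_sum [Fintype M] (ρ : Representation R M V) (z : MonoidAlgebra R M)
    (v : V) : ρ.asAlgebraHom z v = ∑ m, z.coeff m • ρ m v := by
  rw [Representation.asAlgebraHom_def, MonoidAlgebra.lift_apply,
    Finsupp.sum_fintype _ _ fun m => zero_smul R (ρ m), LinearMap.sum_apply]
  rfl

theorem cInd_map_cIndSingle (hφ : Function.Injective φ) (ρ : Representation R H V) (h : H) (v : V) :
    cInd φ ρ (φ h) (cIndSingle hφ ρ v) = cIndSingle hφ ρ (ρ h v) := by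
  ext g
  change (cIndSingle hφ ρ v).1 (g * φ h) = _
  by_cases hg : g ∈ φ.range
  · obtain ⟨a, rfl⟩ := hg
    rw [← map_mul, cIndSingle_apply_map, cIndSingle_apply_map, map_mul, Module.End.mul_apply]
  · rw [cIndSingle_apply_of_notMem_range hφ _ hg, cIndSingle_apply_of_notMem_range hφ]
    rwa [Subgroup.mul_mem_cancel_right _ (MonoidHom.mem_range.2 ⟨h, rfl⟩)]

variable [TopologicalSpace G] [IsTopologicalGroup G]

theorem isSmoothVector_cInd {ρ : Representation R H V} {L : Subgroup H}
    (hL : IsOpen (L.map φ : Set G)) (hρ : ∀ h ∈ L, ρ h = 1) (f : cIndV φ ρ) :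
    IsSmoothVector (cInd φ ρ) f := by
  obtain ⟨s, hs⟩ := f.2.2
  have apply_mul_eq {u : G} (hu : ∀ x ∈ s, x * u * x⁻¹ ∈ L.map φ) {g : G} (hg : f.1 g ≠ 0) :
      f.1 (g * u) = f.1 g := by
    obtain ⟨h, x, hx, rfl⟩ := hs g hg
    obtain ⟨l, hl, hlu⟩ := hu x hx
    rw [mul_assoc, ← inv_mul_cancel_right (x * u) x, ← hlu, f.2.1, f.2.1, f.2.1, hρ l hl,
      Module.End.one_apply]
  have hconj (x : G) : ∀ᶠ u in 𝓝 (1 : G), x * u * x⁻¹ ∈ L.map φ :=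
    ((IsTopologicalGroup.continuous_conj x).tendsto' 1 1 (by group)).eventually
      (hL.mem_nhds (L.map φ).one_mem)
  filter_upwards [(Filter.eventually_all_finset s).2 fun x _ => hconj x] with u hu
  refine Subtype.ext <| funext fun g => ?_
  change f.1 (g * u) = f.1 g
  by_cases hg : f.1 g = 0
  · by_contra hgu
    have hu' (x) (hx : x ∈ s) : x * u⁻¹ * x⁻¹ ∈ L.map φ := by
      simpa only [mul_inv_rev, inv_inv, mul_assoc] using inv_mem (hu x hx)
    exact hgu (by rw [← apply_mul_eq hu' (hg ▸ hgu), mul_inv_cancel_right])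
  · exact apply_mul_eq hu hg

theorem isSmoothVector_cInd_comp (hopen : IsOpen (q.ker.map φ : Set G)) {ρ : Representation R M V}
    (f : cIndV φ (ρ.comp q)) : IsSmoothVector (cInd φ (ρ.comp q)) f :=
  isSmoothVector_cInd hopen (fun h hh => by rw [MonoidHom.comp_apply, hh, map_one]) f

variable {π : Representation R M W} {ρ : Representation R M V} {σ : Representation R G X}

theorem heckeAction_apply_mem_groupAnnSpan
    [Module.Projective (MonoidAlgebra R M) ρ.asModule]
    (hU₀ : AdmitsHaarMeasure R (q.ker.map φ)) {ι : (cInd φ (π.comp q)).IntertwiningMap σ}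
    (hι : Function.Injective ι) {f : G → R} (hf : f ∈ heckeAnn (q.ker.map φ) σ)
    (v : cIndV φ (ρ.comp q)) (g : G) :
    (heckeAction (q.ker.map φ) (cInd φ (ρ.comp q)) f v).1 g ∈ groupAnnSpan π ρ := by
  refine mem_groupAnnSpan_of_forall_intertwiningMap fun T => ?_
  let T' : (cInd φ (ρ.comp q)).IntertwiningMap (cInd φ (π.comp q)) :=
    cIndMap φ ⟨T.toLinearMap, fun h => T.isIntertwining' (q h)⟩
  have hsmooth := isSmoothVector_cInd_comp (ρ := ρ) hU₀.isOpen v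
  have hT' : T' (heckeAction (q.ker.map φ) (cInd φ (ρ.comp q)) f v) = 0 := by
    apply hι
    rw [← heckeAction_map hU₀ (isTestFunction_of_mem_heckeAlgebra hf.1) hsmooth T',
      ← heckeAction_map hU₀ (isTestFunction_of_mem_heckeAlgebra hf.1) (hsmooth.map T') ι, hf.2,
      map_zero]
  exact congrFun (congrArg Subtype.val hT') g

variable [Fintype M] {a : M → H}

theorem heckeCosetSum_mem_heckeAnn (hU₀ : AdmitsHaarMeasure R (q.ker.map φ))
    (hcompact : IsCompact (q.ker.map φ : Set G)) (hσ : ∀ x, IsSmoothVector σ x) {z : M → R}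
    (hz : ∀ x, (∀ u ∈ q.ker.map φ, σ u x = x) → ∑ m, z m • σ (φ (a m)) x = 0) :
    heckeCosetSum R (q.ker.map φ) (fun m => φ (a m)) z ∈ heckeAnn (q.ker.map φ) σ := by
  refine ⟨heckeCosetSum_mem_heckeAlgebra hU₀.isOpen hcompact _ z, fun x => ?_⟩
  rw [heckeAction_heckeCosetSum hU₀ hcompact _ z (hσ x)]
  exact hz _ fun u hu => map_heckeAction_heckeIdempotent σ x hu

theorem heckeAction_heckeCosetSum_cIndSingle (hφ : Function.Injective φ)
    (ha : Function.RightInverse a q) (hU₀ : AdmitsHaarMeasure R (q.ker.map φ))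
    (hcompact : IsCompact (q.ker.map φ : Set G)) (z : MonoidAlgebra R M) (v : V) :
    heckeAction (q.ker.map φ) (cInd φ (ρ.comp q))
        (heckeCosetSum R (q.ker.map φ) (fun m => φ (a m)) z.coeff)
        (cIndSingle hφ (ρ.comp q) v) =
      cIndSingle hφ (ρ.comp q) (ρ.asAlgebraHom z v) := by
  have hinv : ∀ u ∈ q.ker.map φ, cInd φ (ρ.comp q) u (cIndSingle hφ (ρ.comp q) v) =
      cIndSingle hφ (ρ.comp q) v := by
    rintro _ ⟨h, hh, rfl⟩
    rw [cInd_map_cIndSingle, MonoidHom.comp_apply, hh, map_one, Module.End.one_apply]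
  rw [heckeAction_heckeCosetSum hU₀ hcompact _ _ (isSmoothVector_cInd_comp hU₀.isOpen _),
    heckeAction_heckeIdempotent_of_invariant hinv, asAlgebraHom_apply_eq_sum, map_sum]
  refine Finset.sum_congr rfl fun m _ => ?_
  rw [cInd_map_cIndSingle, MonoidHom.comp_apply, ha m, map_smul]

theorem mem_heckeAnnSpan_cInd_iff [Module.Projective (MonoidAlgebra R M) ρ.asModule]
    (hφ : Function.Injective φ) (ha : Function.RightInverse a q)
    (hU₀ : AdmitsHaarMeasure R (q.ker.map φ)) (hcompact : IsCompact (q.ker.map φ : Set G))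
    (hσ : ∀ x, IsSmoothVector σ x) {ι : (cInd φ (π.comp q)).IntertwiningMap σ}
    (hι : Function.Injective ι)
    (hann : ∀ z ∈ groupAnn π, ∀ x, (∀ u ∈ q.ker.map φ, σ u x = x) →
      ∑ m, z.coeff m • σ (φ (a m)) x = 0) {f : cIndV φ (ρ.comp q)} :
    f ∈ heckeAnnSpan (q.ker.map φ) σ (cInd φ (ρ.comp q)) ↔ ∀ g, f.1 g ∈ groupAnnSpan π ρ := by
  constructor
  · intro hf g
    refine Submodule.span_le (p := (groupAnnSpan π ρ).comap
      (LinearMap.proj g ∘ₗ (cIndV φ (ρ.comp q)).subtype)).2 ?_ hf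
    rintro _ ⟨f, hf, v, rfl⟩
    exact heckeAction_apply_mem_groupAnnSpan hU₀ hι hf v g
  · refine mem_of_forall_cIndSingle_mem hφ (heckeAnnSpan_stable _ _ _) fun v hv => ?_
    refine Submodule.span_le (p := (heckeAnnSpan (q.ker.map φ) σ (cInd φ (ρ.comp q))).comap
      (cIndSingle hφ (ρ.comp q))).2 ?_ hv
    rintro _ ⟨z, hz, v, rfl⟩
    exact Submodule.subset_span ⟨_, heckeCosetSum_mem_heckeAnn hU₀ hcompact hσ (hann z hz), _,
      heckeAction_heckeCosetSum_cIndSingle hφ ha hU₀ hcompact z v⟩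

end InflatedInduction

section Congruence

variable {O : Type*} [CommRing O] {n : ℕ}

/-- The congruence subgroup of level `I` in `GL_n(O)`, the kernel of reduction modulo `I`. -/
def congruenceSubgroup (n : ℕ) (I : Ideal O) : Subgroup (GL (Fin n) O) :=
  (Matrix.GeneralLinearGroup.map (Ideal.Quotient.mk I)).ker

variable {I J : Ideal O} {g : GL (Fin n) O}

theorem mem_congruenceSubgroup_iff_mapMatrix :
    g ∈ congruenceSubgroup n I ↔
      (Ideal.Quotient.mk I).mapMatrix (g : Matrix (Fin n) (Fin n) O) = 1 :=
  Units.ext_iff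

theorem mem_congruenceSubgroup_iff :
    g ∈ congruenceSubgroup n I ↔ ∀ i j, ((g : Matrix (Fin n) (Fin n) O) - 1) i j ∈ I := by
  rw [mem_congruenceSubgroup_iff_mapMatrix, ← map_one (Ideal.Quotient.mk I).mapMatrix,
    ← sub_eq_zero, ← map_sub, ← Matrix.ext_iff]
  exact forall₂_congr fun i j => Ideal.Quotient.eq_zero_iff_mem

theorem congruenceSubgroup_mono (h : I ≤ J) : congruenceSubgroup n I ≤ congruenceSubgroup n J :=
  fun _ hg => mem_congruenceSubgroup_iff.2 fun i j => h (mem_congruenceSubgroup_iff.1 hg i j)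

theorem geom_sum_apply_mem_of_mem_congruenceSubgroup {p : ℕ} (hp : (p : O) ∈ I)
    (hg : g ∈ congruenceSubgroup n I) (i j : Fin n) :
    (∑ l ∈ Finset.range p, (g : Matrix (Fin n) (Fin n) O) ^ l) i j ∈ I := by
  have hsum : (Ideal.Quotient.mk I).mapMatrix
      (∑ l ∈ Finset.range p, (g : Matrix (Fin n) (Fin n) O) ^ l) = 0 := by
    simp only [map_sum, map_pow, mem_congruenceSubgroup_iff_mapMatrix.1 hg, one_pow,
      Finset.sum_const, Finset.card_range]
    rw [← Nat.cast_smul_eq_nsmul (O ⧸ I), ← map_natCast (Ideal.Quotient.mk I),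
      Ideal.Quotient.eq_zero_iff_mem.2 hp, zero_smul]
  exact Ideal.Quotient.eq_zero_iff_mem.1 (congrFun (congrFun hsum i) j)

theorem pow_mem_congruenceSubgroup_mul {p : ℕ} (hp : (p : O) ∈ I) (hJI : J ≤ I)
    (hg : g ∈ congruenceSubgroup n J) : g ^ p ∈ congruenceSubgroup n (J * I) := by
  refine mem_congruenceSubgroup_iff.2 fun i j => ?_
  rw [Units.val_pow_eq_pow_val, ← mul_geom_sum, Matrix.mul_apply]
  exact sum_mem fun l _ => Ideal.mul_mem_mul (mem_congruenceSubgroup_iff.1 hg i l)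
    (geom_sum_apply_mem_of_mem_congruenceSubgroup hp (congruenceSubgroup_mono hJI hg) l j)

theorem pow_pow_mem_congruenceSubgroup {p : ℕ} (hp : (p : O) ∈ I)
    (hg : g ∈ congruenceSubgroup n I) (m : ℕ) :
    g ^ p ^ m ∈ congruenceSubgroup n (I ^ (m + 1)) := by
  induction m with
  | zero => simpa only [pow_zero, zero_add, pow_one] using hg
  | succ m ih =>
    rw [pow_succ p, pow_mul, pow_succ I]
    exact pow_mem_congruenceSubgroup_mul hp (Ideal.pow_le_self m.succ_ne_zero) ih

theorem exists_relIndex_congruenceSubgroup_eq_pow {p : ℕ} [Fact p.Prime]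
    (hp : (p : O) ∈ I) (m : ℕ) [Finite (O ⧸ I ^ (m + 1))] :
    ∃ a, (congruenceSubgroup n (I ^ (m + 1))).relIndex (congruenceSubgroup n I) = p ^ a := by
  have : (congruenceSubgroup n (I ^ (m + 1))).Normal := MonoidHom.normal_ker _
  have : (congruenceSubgroup n (I ^ (m + 1))).FiniteIndex := Subgroup.finiteIndex_ker _
  have hP : IsPGroup p (congruenceSubgroup n I ⧸
      (congruenceSubgroup n (I ^ (m + 1))).subgroupOf (congruenceSubgroup n I)) := fun x => by
    obtain ⟨g, rfl⟩ := QuotientGroup.mk_surjective x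
    exact ⟨m, (QuotientGroup.eq_one_iff _).2 (pow_pow_mem_congruenceSubgroup hp g.2 m)⟩
  exact IsPGroup.iff_card.1 hP

open Topology

variable [TopologicalSpace O] [IsTopologicalRing O]

theorem isOpen_congruenceSubgroup (hI : IsOpen (I : Set O)) :
    IsOpen (congruenceSubgroup n I : Set (GL (Fin n) O)) := by
  have hinter : (congruenceSubgroup n I : Set (GL (Fin n) O)) =
      ⋂ i, ⋂ j, (fun g : GL (Fin n) O => ((g : Matrix (Fin n) (Fin n) O) - 1) i j) ⁻¹' I := by
    ext g
    simp only [Set.mem_iInter, Set.mem_preimage, SetLike.mem_coe, mem_congruenceSubgroup_iff]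
  rw [hinter]
  refine isOpen_iInter_of_finite fun i => isOpen_iInter_of_finite fun j => hI.preimage ?_
  exact (Units.continuous_val.sub continuous_const).matrix_elem i j

theorem isClosed_congruenceSubgroup (hI : IsOpen (I : Set O)) :
    IsClosed (congruenceSubgroup n I : Set (GL (Fin n) O)) :=
  Subgroup.isClosed_of_isOpen _ (isOpen_congruenceSubgroup hI)

variable [CompactSpace O] [T2Space O]

theorem compactSpace_GL : CompactSpace (GL (Fin n) O) := by
  have : CompactSpace (Matrix (Fin n) (Fin n) O) :=
    inferInstanceAs (CompactSpace (Fin n → Fin n → O))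
  infer_instance

open IsLocalRing

variable [IsLocalRing O] [IsNoetherianRing O]

theorem exists_congruenceSubgroup_subset {N : Set (GL (Fin n) O)} (hN : N ∈ 𝓝 1) :
    ∃ m, (congruenceSubgroup n (maximalIdeal O ^ (m + 1)) : Set (GL (Fin n) O)) ⊆ N := by
  have := compactSpace_GL (O := O) (n := n)
  have hclosed (m : ℕ) : IsClosed
      (congruenceSubgroup n (maximalIdeal O ^ (m + 1)) : Set (GL (Fin n) O)) :=
    isClosed_congruenceSubgroup (isOpen_maximalIdeal_pow O _)
  have hone {x : GL (Fin n) O}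
      (hx : ∀ m, x ∈ congruenceSubgroup n (maximalIdeal O ^ (m + 1))) : x = 1 := by
    ext i j : 2
    rw [← sub_eq_zero, ← Ideal.mem_bot, ← Ideal.iInf_pow_eq_bot_of_isLocalRing (maximalIdeal O)
      (Ideal.IsPrime.ne_top inferInstance), Ideal.mem_iInf]
    exact fun m => Ideal.pow_le_pow_right m.le_succ (mem_congruenceSubgroup_iff.1 (hx m) i j)
  refine exists_subset_nhds_of_isCompact' (directed_of_isDirected_le fun a b hab => ?_)
    (fun m => (hclosed m).isCompact) hclosed fun x hx => ?_
  · exact congruenceSubgroup_mono (Ideal.pow_le_pow_right (Nat.succ_le_succ hab))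
  · rwa [hone (Set.mem_iInter.1 hx)]

theorem admitsHaarMeasure_map_congruenceSubgroup {R : Type*} [Field R] {p : ℕ}
    [CharP (ResidueField O) p] (hp : (p : R) ≠ 0) {G : Type*} [Group G] [TopologicalSpace G]
    {φ : GL (Fin n) O →* G} (hφ : IsOpenEmbedding φ) :
    AdmitsHaarMeasure R ((congruenceSubgroup n (maximalIdeal O)).map φ) := by
  intro N hN
  obtain ⟨m, hm⟩ := exists_congruenceSubgroup_subset
    (hφ.continuous.continuousAt.preimage_mem_nhds (by rwa [map_one]))
  have hpO : (p : O) ∈ maximalIdeal O := by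
    rw [← residue_eq_zero_iff, map_natCast, CharP.cast_eq_zero]
  have : Finite (ResidueField O) := isOpen_iff_finite_quotient.1 (isOpen_maximalIdeal O)
  have : Fact p.Prime := ⟨CharP.char_is_prime (ResidueField O) p⟩
  have : Finite (O ⧸ maximalIdeal O ^ (m + 1)) :=
    isOpen_iff_finite_quotient.1 (isOpen_maximalIdeal_pow O (m + 1))
  obtain ⟨a, ha⟩ := exists_relIndex_congruenceSubgroup_eq_pow (n := n) hpO m
  refine ⟨(congruenceSubgroup n (maximalIdeal O ^ (m + 1))).map φ, Subgroup.map_mono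
    (congruenceSubgroup_mono (Ideal.pow_le_self m.succ_ne_zero)),
    hφ.isOpenMap _ (isOpen_congruenceSubgroup (isOpen_maximalIdeal_pow O _)),
    Set.image_subset_iff.2 hm, ?_⟩
  rw [Subgroup.relIndex_map_map_of_injective _ _ hφ.injective, ha, Nat.cast_pow]
  exact pow_ne_zero a hp

end Congruence

section LocalField

open Topology IsLocalRing

theorem isOpenEmbedding_unitsMap {A B : Type*} [Monoid A] [TopologicalSpace A] [Monoid B]
    [TopologicalSpace B] {f : A →* B} (hf : IsOpenEmbedding f) :
    IsOpenEmbedding (Units.map f) := by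
  refine ⟨hf.isEmbedding.units_map, ?_⟩
  have hrange : Set.range (Units.map f) =
      (Units.val ⁻¹' Set.range f) ∩ ((fun u : Bˣ => ↑u⁻¹) ⁻¹' Set.range f) := by
    refine Set.Subset.antisymm (Set.range_subset_iff.2 fun u => ⟨⟨u, rfl⟩, ⟨↑u⁻¹, rfl⟩⟩) ?_
    rintro u ⟨⟨a, ha⟩, ⟨b, hb⟩⟩
    exact ⟨⟨a, b, hf.injective (by rw [map_mul, ha, hb, map_one, Units.mul_inv]),
      hf.injective (by rw [map_mul, ha, hb, map_one, Units.inv_mul])⟩, Units.ext ha⟩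
  rw [hrange]
  exact (hf.isOpen_range.preimage Units.continuous_val).inter
    (hf.isOpen_range.preimage Units.continuous_coe_inv)

variable {F : Type*} [Field F] [ValuativeRel F] {n : ℕ}

theorem inclK_injective : Function.Injective (inclK F n) :=
  Units.map_injective (Matrix.map_injective Subtype.val_injective)

variable [TopologicalSpace F] [IsNonarchimedeanLocalField F]

variable (F) in
theorem t2Space_localField : T2Space F := by
  let := IsTopologicalAddGroup.rightUniformSpace F
  have := isUniformAddGroup_of_addCommGroup (G := F)
  infer_instance

variable (F) in
theorem isOpen_integers : IsOpen (𝒪[F] : Set F) := by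
  let := IsTopologicalAddGroup.rightUniformSpace F
  have := isUniformAddGroup_of_addCommGroup (G := F)
  exact Valued.isOpen_integer F

variable (F n) in
theorem isOpenEmbedding_inclK : IsOpenEmbedding (inclK F n) :=
  isOpenEmbedding_unitsMap (isOpen_integers F).isOpenEmbedding_subtypeVal.matrix_map

theorem admitsHaarMeasure_proRadical {R : Type*} [Field R] {p : ℕ} [CharP 𝓀[F] p]
    (hp : (p : R) ≠ 0) : AdmitsHaarMeasure R (proRadical F n) :=
  have := t2Space_localField F
  admitsHaarMeasure_map_congruenceSubgroup hp (isOpenEmbedding_inclK F n)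

variable (F n) in
theorem isOpen_proRadical : IsOpen (proRadical F n : Set (GL (Fin n) F)) :=
  have := t2Space_localField F
  (isOpenEmbedding_inclK F n).isOpenMap _ (isOpen_congruenceSubgroup (isOpen_maximalIdeal 𝒪[F]))

variable (F n) in
theorem isCompact_proRadical : IsCompact (proRadical F n : Set (GL (Fin n) F)) := by
  have := t2Space_localField F
  have := compactSpace_GL (O := 𝒪[F]) (n := n)
  exact (isClosed_congruenceSubgroup (isOpen_maximalIdeal 𝒪[F])).isCompact.image
    (isOpenEmbedding_inclK F n).continuous

end LocalField

section IwahoriDecomposition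

section Pivot

variable {k : Type*} [Field k] {n : ℕ}

/-- Row `a` of `A` has a unique nonzero entry, and it is alone in its column. -/
def IsPivotRow (A : Matrix (Fin n) (Fin n) k) (a : Fin n) : Prop :=
  ∃ j, A a j ≠ 0 ∧ (∀ l, l ≠ j → A a l = 0) ∧ ∀ i, i ≠ a → A i j = 0

theorem IsPivotRow.apply_eq_zero {A : Matrix (Fin n) (Fin n) k} {a i j : Fin n}
    (ha : IsPivotRow A a) (hia : i ≠ a) (hij : A i j ≠ 0) : A a j = 0 := by
  obtain ⟨l, -, hrow, hcol⟩ := ha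
  refine hrow j ?_
  rintro rfl
  exact hij (hcol i hia)

theorem isPivotRow_of_clear {A B : Matrix (Fin n) (Fin n) k} {a b j : Fin n} (h0 : A a j ≠ 0)
    (hB : ∀ i l, B i l = if i = a then (if l = j then A a j else 0)
      else A i l - A i j * A a l / A a j)
    (hb : b = a ∨ IsPivotRow A b) : IsPivotRow B b := by
  rcases eq_or_ne b a with rfl | hba
  · refine ⟨j, by simpa [hB] using h0, fun l hl => by simp [hB, hl], fun i hi => ?_⟩
    rw [hB, if_neg hi, mul_div_cancel_right₀ _ h0, sub_self]
  · have hpiv := hb.resolve_left hba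
    have hbj : A b j = 0 := hpiv.apply_eq_zero hba.symm h0
    have hrowb (l : Fin n) : B b l = A b l := by
      rw [hB, if_neg hba, hbj, zero_mul, zero_div, sub_zero]
    obtain ⟨l, hl0, hrow, hcol⟩ := hpiv
    have hlj : l ≠ j := fun h => hl0 (h ▸ hbj)
    refine ⟨l, by rwa [hrowb], fun m hm => by rw [hrowb, hrow m hm], fun i hi => ?_⟩
    rcases eq_or_ne i a with rfl | hia
    · simp [hB, hlj]
    · rw [hB, if_neg hia, hcol i hi, hcol a hba.symm, mul_zero, zero_div, sub_zero]

end Pivot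

open ValuativeRel

variable {F : Type*} [Field F] [ValuativeRel F] {n : ℕ}

theorem mem_range_inclK {g : GL (Fin n) F} (hg : g.1 ∈ 𝒪[F].matrix)
    (hg' : (g⁻¹).1 ∈ 𝒪[F].matrix) : g ∈ (inclK F n).range := by
  have hinj : Function.Injective (𝒪[F].subtype.mapMatrix (m := Fin n)) :=
    Matrix.map_injective Subtype.val_injective
  let A : Matrix (Fin n) (Fin n) 𝒪[F] := Matrix.of fun i j => ⟨_, hg i j⟩
  let B : Matrix (Fin n) (Fin n) 𝒪[F] := Matrix.of fun i j => ⟨_, hg' i j⟩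
  have hA : 𝒪[F].subtype.mapMatrix A = g.1 := rfl
  have hB : 𝒪[F].subtype.mapMatrix B = (g⁻¹).1 := rfl
  refine ⟨⟨A, B, hinj ?_, hinj ?_⟩, Units.ext hA⟩
  · rw [map_mul, hA, hB, map_one, Units.mul_inv]
  · rw [map_mul, hA, hB, map_one, Units.inv_mul]

theorem mem_iwahori {g : GL (Fin n) F} (hg : g.1 ∈ 𝒪[F].matrix) (hg' : (g⁻¹).1 ∈ 𝒪[F].matrix)
    (hlt : ∀ i j, j < i → valuation F (g.1 i j) < 1) : g ∈ iwahori F n := by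
  obtain ⟨κ, rfl⟩ := mem_range_inclK hg hg'
  refine Subgroup.mem_map_of_mem _ fun i j hij => ?_
  refine (IsLocalRing.residue_eq_zero_iff _).2 ?_
  rw [IsLocalRing.mem_maximalIdeal, mem_nonunits_iff,
    Valuation.Integer.not_isUnit_iff_valuation_lt_one]
  exact hlt i j hij

section Shear

variable {A : Type*} [CommRing A]

/-- The invertible matrix `1 + x yᵀ`, for orthogonal vectors `x` and `y`. -/
def shear (x y : Fin n → A) (h : y ⬝ᵥ x = 0) : GL (Fin n) A where
  val := 1 + Matrix.vecMulVec x y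
  inv := 1 - Matrix.vecMulVec x y
  val_inv := by
    rw [add_mul, mul_sub, mul_sub, Matrix.vecMulVec_mul_vecMulVec, h, zero_smul,
      Matrix.vecMulVec_zero]
    noncomm_ring
  inv_val := by
    rw [sub_mul, mul_add, mul_add, Matrix.vecMulVec_mul_vecMulVec, h, zero_smul,
      Matrix.vecMulVec_zero]
    noncomm_ring

variable {x y : Fin n → A} {h : y ⬝ᵥ x = 0} {S : Subring A}

theorem shear_mem_matrix (hx : ∀ i, x i ∈ S) (hy : ∀ i, y i ∈ S) : (shear x y h).1 ∈ S.matrix :=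
  add_mem (one_mem _) fun i j => S.mul_mem (hx i) (hy j)

theorem inv_shear_mem_matrix (hx : ∀ i, x i ∈ S) (hy : ∀ i, y i ∈ S) :
    ((shear x y h)⁻¹).1 ∈ S.matrix :=
  sub_mem (one_mem _) fun i j => S.mul_mem (hx i) (hy j)

theorem shear_mul_apply {y : Fin n → A} {a : Fin n} (h : Pi.single a 1 ⬝ᵥ y = 0)
    (g : GL (Fin n) A) (i j : Fin n) :
    (shear y (Pi.single a 1) h * g).1 i j = g.1 i j + y i * g.1 a j := by
  change ((1 + Matrix.vecMulVec y (Pi.single a 1)) * g.1) i j = _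
  rw [add_mul, one_mul, Matrix.vecMulVec_mul, Matrix.single_one_vecMul]
  rfl

theorem mul_shear_apply {x : Fin n → A} {a : Fin n} (h : x ⬝ᵥ Pi.single a 1 = 0)
    (g : GL (Fin n) A) (i j : Fin n) :
    (g * shear (Pi.single a 1) x h).1 i j = g.1 i j + g.1 i a * x j := by
  change (g.1 * (1 + Matrix.vecMulVec (Pi.single a 1) x)) i j = _
  rw [mul_add, mul_one, Matrix.mul_vecMulVec, Matrix.mulVec_single_one]
  rfl

end Shear

theorem update_neg_div_mem_integers {x : Fin n → F} {d : F} (hd : d ≠ 0)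
    (hx : ∀ i, valuation F (x i) ≤ valuation F d) (a i : Fin n) :
    Function.update (fun i => -(x i / d)) a 0 i ∈ 𝒪[F] := by
  rcases eq_or_ne i a with rfl | hi
  · simpa only [Function.update_self] using zero_mem 𝒪[F]
  · simp only [Function.update_of_ne hi, Valuation.mem_integer_iff, Valuation.map_neg, map_div₀,
      div_le_one₀ ((Valuation.pos_iff (valuation F)).2 hd), hx]

theorem exists_clear_row_col {A : GL (Fin n) F} {a j : Fin n} (h0 : A.1 a j ≠ 0)
    (hrow : ∀ l, valuation F (A.1 a l) ≤ valuation F (A.1 a j))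
    (hcol : ∀ i, valuation F (A.1 i j) ≤ valuation F (A.1 a j))
    (hbelow : ∀ i, a < i → valuation F (A.1 i j) < valuation F (A.1 a j)) :
    ∃ ι ∈ iwahori F n, ∃ κ : GL (Fin n) 𝒪[F], ∀ i l, (ι * A * inclK F n κ).1 i l =
      if i = a then (if l = j then A.1 a j else 0)
      else A.1 i l - A.1 i j * A.1 a l / A.1 a j := by
  let c : Fin n → F := Function.update (fun i => -(A.1 i j / A.1 a j)) a 0
  let r : Fin n → F := Function.update (fun l => -(A.1 a l / A.1 a j)) j 0
  have hc : ∀ i, c i ∈ 𝒪[F] := update_neg_div_mem_integers h0 hcol a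
  have hr : ∀ l, r l ∈ 𝒪[F] := update_neg_div_mem_integers h0 hrow j
  have hsingle (a i : Fin n) : (Pi.single a 1 : Fin n → F) i ∈ 𝒪[F] := by
    rw [Pi.single_apply]
    split_ifs
    exacts [one_mem _, zero_mem _]
  have hca : Pi.single a 1 ⬝ᵥ c = 0 := by simp [c]
  have hrj : r ⬝ᵥ Pi.single j 1 = 0 := by simp [r]
  obtain ⟨κ, hκ⟩ := mem_range_inclK (shear_mem_matrix (h := hrj) (hsingle j) hr)
    (inv_shear_mem_matrix (hsingle j) hr)
  refine ⟨shear c (Pi.single a 1) hca, mem_iwahori (shear_mem_matrix hc (hsingle a))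
    (inv_shear_mem_matrix hc (hsingle a)) fun i l hil => ?_, κ, fun i l => ?_⟩
  · rw [← mul_one (shear _ _ _), shear_mul_apply, Units.val_one,
      Matrix.one_apply_ne hil.ne', zero_add]
    rcases eq_or_ne a l with rfl | hal
    · simpa [c, hil.ne', div_lt_one₀ ((Valuation.pos_iff (valuation F)).2 h0)] using hbelow i hil
    · simp [Matrix.one_apply_ne hal]
  · rw [hκ, mul_shear_apply, shear_mul_apply, shear_mul_apply]
    rcases eq_or_ne i a with rfl | hi <;> rcases eq_or_ne l j with rfl | hl <;>
      simp only [c, r, Function.update_self, if_true, if_false, *, ne_eq, not_false_eq_true,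
        Function.update_of_ne] <;>
      field_simp <;> ring

/-- The witness is an entry of largest valuation in the remaining rows and, among these, of
largest row index: elements of the Iwahori subgroup may only clear downwards with coefficients in
the maximal ideal. -/
theorem exists_dominant_entry (A : GL (Fin n) F) {S : Finset (Fin n)} (hS : S ≠ Finset.univ)
    (hA : ∀ a ∈ S, IsPivotRow A.1 a) :
    ∃ a ∉ S, ∃ j, A.1 a j ≠ 0 ∧ (∀ l, valuation F (A.1 a l) ≤ valuation F (A.1 a j)) ∧
      (∀ i, valuation F (A.1 i j) ≤ valuation F (A.1 a j)) ∧
      ∀ i, a < i → valuation F (A.1 i j) < valuation F (A.1 a j) := by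
  obtain ⟨a₀, ha₀⟩ : ∃ a, a ∉ S := by simpa [Finset.eq_univ_iff_forall] using hS
  obtain ⟨j₀, hj₀⟩ : ∃ j, A.1 a₀ j ≠ 0 := by
    by_contra! h
    exact A.det.ne_zero (Matrix.det_eq_zero_of_row_eq_zero a₀ h)
  obtain ⟨⟨a, j⟩, haS, hmax⟩ := (Sᶜ ×ˢ Finset.univ).exists_max_image
    (fun x => toLex (valuation F (A.1 x.1 x.2), x.1)) ⟨(a₀, j₀), by simpa using ha₀⟩
  replace haS : a ∉ S := by simpa using haS
  have hle (i l : Fin n) (hi : i ∉ S) : valuation F (A.1 i l) < valuation F (A.1 a j) ∨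
      valuation F (A.1 i l) = valuation F (A.1 a j) ∧ i ≤ a := by
    simpa [Prod.Lex.le_iff] using hmax (i, l) (by simpa using hi)
  have hle' (i l : Fin n) (hi : i ∉ S) : valuation F (A.1 i l) ≤ valuation F (A.1 a j) :=
    (hle i l hi).elim le_of_lt fun h => h.1.le
  have hpos : 0 < valuation F (A.1 a j) :=
    ((Valuation.pos_iff _).2 hj₀).trans_le (hle' a₀ j₀ ha₀)
  have h0 : A.1 a j ≠ 0 := (Valuation.pos_iff _).1 hpos
  have hSj (i : Fin n) (hi : i ∈ S) : valuation F (A.1 i j) < valuation F (A.1 a j) := by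
    rwa [(hA i hi).apply_eq_zero (by rintro rfl; exact haS hi) h0, map_zero]
  refine ⟨a, haS, j, h0, fun l => hle' a l haS, fun i => ?_, fun i hi => ?_⟩
  · exact (em (i ∈ S)).elim (fun h => (hSj i h).le) (hle' i j)
  · exact (em (i ∈ S)).elim (hSj i) fun h =>
      (hle i j h).resolve_right fun h' => h'.2.not_gt hi

theorem exists_forall_isPivotRow (y : GL (Fin n) F) :
    ∃ ι ∈ iwahori F n, ∃ κ : GL (Fin n) 𝒪[F], ∀ a, IsPivotRow (ι * y * inclK F n κ).1 a := by
  suffices h : ∀ m ≤ n, ∃ S : Finset (Fin n), S.card = m ∧ ∃ ι ∈ iwahori F n,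
      ∃ κ : GL (Fin n) 𝒪[F], ∀ a ∈ S, IsPivotRow (ι * y * inclK F n κ).1 a by
    obtain ⟨S, hS, ι, hι, κ, hpiv⟩ := h n le_rfl
    have huniv : S = Finset.univ := by rw [← Finset.card_eq_iff_eq_univ, hS, Fintype.card_fin]
    exact ⟨ι, hι, κ, fun a => hpiv a (huniv ▸ Finset.mem_univ a)⟩
  intro m hm
  induction m with
  | zero => exact ⟨∅, rfl, 1, one_mem _, 1, fun a ha => absurd ha (Finset.notMem_empty a)⟩
  | succ m ih =>
    obtain ⟨S, hSm, ι, hι, κ, hS⟩ := ih (Nat.le_of_succ_le hm)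
    have hne : S ≠ Finset.univ := by
      rintro rfl
      rw [Finset.card_univ, Fintype.card_fin] at hSm
      omega
    obtain ⟨a, haS, j, h0, hrow, hcol, hbelow⟩ := exists_dominant_entry _ hne hS
    obtain ⟨ι', hι', κ', hclear⟩ := exists_clear_row_col h0 hrow hcol hbelow
    refine ⟨insert a S, by rw [Finset.card_insert_of_notMem haS, hSm], ι' * ι, mul_mem hι' hι,
      κ * κ', fun b hb => ?_⟩
    simpa only [map_mul, mul_assoc] using
      isPivotRow_of_clear h0 hclear ((Finset.mem_insert.1 hb).imp_right (hS b))

/-- The monomial matrix with entries `d a` at `(a, r a)`, with the entries increasing along the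
columns for the lexicographic order given by the valuation and then the row. -/
structure IsSortedMonomial (A : Matrix (Fin n) (Fin n) F) (d : Fin n → F)
    (r : Equiv.Perm (Fin n)) : Prop where
  apply_eq (i j : Fin n) : A i j = if r i = j then d i else 0
  lt_or_eq {i j : Fin n} : r i ≤ r j → valuation F (d i) < valuation F (d j) ∨
    valuation F (d i) = valuation F (d j) ∧ i ≤ j

theorem mul_inclK_permMatrix_apply (A : GL (Fin n) F) (σ : Equiv.Perm (Fin n)) (i j : Fin n) :
    (A * inclK F n (Matrix.permMatrixHom.toHomUnits σ)).1 i j = A.1 i (σ j) := by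
  have hσ : (inclK F n (Matrix.permMatrixHom.toHomUnits σ)).1 = σ⁻¹.permMatrix F :=
    PEquiv.map_toMatrix (algebraMap 𝒪[F] F) _
  rw [Units.val_mul, hσ, Equiv.Perm.permMatrix, PEquiv.mul_toMatrix_toPEquiv]
  rfl

theorem exists_isSortedMonomial (y : GL (Fin n) F) :
    ∃ ι ∈ iwahori F n, ∃ (κ : GL (Fin n) 𝒪[F]) (d : Fin n → F) (r : Equiv.Perm (Fin n)),
      IsSortedMonomial (ι * y * inclK F n κ).1 d r := by
  obtain ⟨ι, hι, κ, hpiv⟩ := exists_forall_isPivotRow y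
  choose c hc0 hrow hcol using hpiv
  have hcinj : Function.Injective c := fun a b h => by
    by_contra hne
    exact hc0 b (h ▸ hcol a b (Ne.symm hne))
  let e : Equiv.Perm (Fin n) := Equiv.ofBijective c (Finite.injective_iff_bijective.1 hcinj)
  let d (a : Fin n) : F := (ι * y * inclK F n κ).1 a (c a)
  let f (a : Fin n) : ValueGroupWithZero F ×ₗ Fin n := toLex (valuation F (d a), a)
  let s : Equiv.Perm (Fin n) := Tuple.sort f
  refine ⟨ι, hι, κ * Matrix.permMatrixHom.toHomUnits (s.trans e), d, s.symm,
    ⟨fun i j => ?_, fun {i j} hij => ?_⟩⟩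
  · rw [map_mul, ← mul_assoc, mul_inclK_permMatrix_apply, Equiv.trans_apply]
    split_ifs with h
    · rw [← h, Equiv.apply_symm_apply]
      rfl
    · exact hrow i _ fun h' => h ((Equiv.symm_apply_eq s).2 (hcinj h').symm)
  · simpa [f, s, Prod.Lex.le_iff] using Tuple.monotone_sort f hij

namespace IsSortedMonomial

variable {M g : GL (Fin n) F} {d : Fin n → F} {r : Equiv.Perm (Fin n)}
  (hM : IsSortedMonomial M.1 d r)
include hM

theorem ne_zero (i : Fin n) : d i ≠ 0 := fun h =>
  M.det.ne_zero (Matrix.det_eq_zero_of_row_eq_zero i fun j => by rw [hM.apply_eq, h, ite_self])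

theorem conj_apply (g : GL (Fin n) F) (i j : Fin n) :
    (M * g * M⁻¹).1 i j = d i * g.1 (r i) (r j) / d j := by
  have h : (M * g * M⁻¹ * M).1 i (r j) = (M * g).1 i (r j) := by rw [inv_mul_cancel_right]
  rw [Units.val_mul, Units.val_mul M g, Matrix.mul_apply, Matrix.mul_apply] at h
  rw [eq_div_iff (hM.ne_zero j)]
  simpa [hM.apply_eq] using h

theorem valuation_conj_apply (hg : g.1 ∈ 𝒪[F].matrix) (htri : g.1.BlockTriangular id)
    (i j : Fin n) : valuation F ((M * g * M⁻¹).1 i j) ≤ 1 ∧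
      (j < i → valuation F ((M * g * M⁻¹).1 i j) < 1) := by
  have hv : 0 < valuation F (d j) := (Valuation.pos_iff _).2 (hM.ne_zero j)
  rw [hM.conj_apply, map_div₀, map_mul, div_le_one₀ hv, div_lt_one₀ hv]
  rcases lt_or_ge (r j) (r i) with h | h
  · rw [htri h, map_zero, mul_zero]
    exact ⟨zero_le, fun _ => hv⟩
  · have hmul : valuation F (d i) * valuation F (g.1 (r i) (r j)) ≤ valuation F (d i) :=
      mul_le_of_le_one_right' (hg _ _)
    rcases hM.lt_or_eq h with hlt | ⟨heq, hle⟩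
    · exact ⟨hmul.trans hlt.le, fun _ => hmul.trans_lt hlt⟩
    · exact ⟨hmul.trans heq.le, fun hji => absurd hle hji.not_ge⟩

theorem conj_mem_iwahori {κ : GL (Fin n) 𝒪[F]} (htri : (inclK F n κ).1.BlockTriangular id) :
    M * inclK F n κ * M⁻¹ ∈ iwahori F n := by
  have hκ := hM.valuation_conj_apply (fun i j => (κ.1 i j).2) htri
  have hκ' := hM.valuation_conj_apply (g := (inclK F n κ)⁻¹) (fun i j => (κ⁻¹.1 i j).2)
    (blockTriangular_inv htri)
  refine mem_iwahori (fun i j => (hκ i j).1) ?_ fun i j => (hκ i j).2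
  have hinv : (M * inclK F n κ * M⁻¹)⁻¹ = M * (inclK F n κ)⁻¹ * M⁻¹ := conj_inv
  rw [hinv]
  exact fun i j => (hκ' i j).1

end IsSortedMonomial

theorem exists_redK_eq_of_map_residue {B : Matrix (Fin n) (Fin n) 𝒪[F]} {b : FinGL 𝓀[F] n}
    (h : B.map (IsLocalRing.residue 𝒪[F]) = b.1) :
    ∃ κ : GL (Fin n) 𝒪[F], κ.1 = B ∧ redK F n κ = b := by
  have hdet : IsUnit B.det := by
    refine isUnit_of_map_unit (IsLocalRing.residue 𝒪[F]) _ ?_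
    rw [RingHom.map_det, RingHom.mapMatrix_apply, h]
    exact b.det.isUnit
  obtain ⟨κ, rfl⟩ := (Matrix.isUnit_iff_isUnit_det B).2 hdet
  exact ⟨κ, rfl, Units.ext h⟩

theorem redK_surjective : Function.Surjective (redK F n) := by
  intro b
  choose B hB using fun i j => IsLocalRing.residue_surjective (R := 𝒪[F]) (b.1 i j)
  obtain ⟨κ, -, hκ⟩ := exists_redK_eq_of_map_residue (B := Matrix.of B) (b := b) (Matrix.ext hB)
  exact ⟨κ, hκ⟩

theorem exists_blockTriangular_redK_eq {b : FinGL 𝓀[F] n} (hb : b ∈ borel 𝓀[F] n) :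
    ∃ κ : GL (Fin n) 𝒪[F], (inclK F n κ).1.BlockTriangular id ∧ redK F n κ = b := by
  choose B hB using fun i j => IsLocalRing.residue_surjective (R := 𝒪[F]) (b.1 i j)
  obtain ⟨κ, hκ, hκb⟩ := exists_redK_eq_of_map_residue
    (B := Matrix.of fun i j => if j < i then 0 else B i j) (b := b) <| by
      ext i j
      rw [Matrix.map_apply, Matrix.of_apply]
      split_ifs with h
      · rw [map_zero]
        exact (hb h).symm
      · exact hB i j
  refine ⟨κ, fun i j hij => ?_, hκb⟩
  change algebraMap 𝒪[F] F (κ.1 i j) = 0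
  rw [hκ, Matrix.of_apply, if_pos (show j < i from hij), map_zero]

theorem exists_borel_conj_lift (y : GL (Fin n) F) :
    ∃ k : GL (Fin n) 𝒪[F], ∀ b ∈ borel 𝓀[F] n, ∃ κ : GL (Fin n) 𝒪[F],
      redK F n κ = b ∧ y * inclK F n (k * κ * k⁻¹) * y⁻¹ ∈ iwahori F n := by
  obtain ⟨ι, hι, k, d, r, hM⟩ := exists_isSortedMonomial y
  refine ⟨k, fun b hb => ?_⟩
  obtain ⟨κ, htri, hκb⟩ := exists_blockTriangular_redK_eq hb
  refine ⟨κ, hκb, ?_⟩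
  convert mul_mem (mul_mem (inv_mem hι) (hM.conj_mem_iwahori htri)) hι using 1
  simp only [map_mul, map_inv]
  group

end IwahoriDecomposition

section Iwahori

section Stages

variable {R : Type*} [CommRing R] {G H M : Type*} [Group G] [Group H] [Group M]
variable {W : Type*} [AddCommGroup W] [Module R W]

variable (R W) in
/-- Induction in stages `ind_H^G infl_M^H ind_B^M 1 → ind_{B'}^G 1`, for the preimage `B'` of `B`
in `H`. -/
def cIndStages (φ : H →* G) {q : H →* M} (hq : Function.Surjective q) (B : Subgroup M) :
    (cInd φ ((cInd B.subtype (Representation.trivial R B W)).comp q)).IntertwiningMap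
      (cInd ((B.comap q).map φ).subtype (Representation.trivial R ((B.comap q).map φ) W)) where
  toLinearMap := (evalAtOne φ q B.subtype (Representation.trivial R B W)).codRestrict _ fun f => by
    classical
    refine ⟨?_, ?_⟩
    · rintro ⟨_, h, hh, rfl⟩ g
      exact evalAtOne_map_mul_of_eq f (u := ⟨q h, hh⟩) rfl g
    · obtain ⟨s, hs⟩ := f.2.2
      choose t ht using fun x => (f.1 x).2.2
      refine ⟨s.biUnion fun x => (t x).image fun m => φ (Function.surjInv hq m) * x,
        fun g hg => ?_⟩
      obtain ⟨h, x, hx, rfl⟩ := hs g fun h0 => hg (congrArg (fun v => v.1 1) h0)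
      rw [evalAtOne_map_mul] at hg
      obtain ⟨b, m, hm, hbm⟩ := ht x (q h) hg
      refine ⟨⟨φ (h * (Function.surjInv hq m)⁻¹), h * (Function.surjInv hq m)⁻¹, ?_, rfl⟩,
        φ (Function.surjInv hq m) * x,
        Finset.mem_biUnion.2 ⟨x, hx, Finset.mem_image_of_mem _ hm⟩, ?_⟩
      · change q (h * (Function.surjInv hq m)⁻¹) ∈ B
        rw [map_mul, map_inv, Function.surjInv_eq hq m, hbm, mul_inv_cancel_right]
        exact b.2
      · rw [Subgroup.subtype_apply, ← mul_assoc, ← map_mul, inv_mul_cancel_right]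
  isIntertwining' _ := rfl

theorem cIndStages_injective (φ : H →* G) {q : H →* M} (hq : Function.Surjective q)
    (B : Subgroup M) : Function.Injective (cIndStages R W φ hq B) :=
  fun _ _ h => evalAtOne_injective hq (congrArg Subtype.val h)

end Stages

theorem sum_coeff_smul_eq_zero_of_mem_groupAnn {R : Type*} [Field R] {M : Type*} [Group M]
    [Fintype M] {W : Type*} [AddCommGroup W] [Module R W] {B : Subgroup M} {z : MonoidAlgebra R M}
    (hz : z ∈ groupAnn (cInd B.subtype (Representation.trivial R B W))) {k : M} {w : M → W}
    (hw : ∀ b ∈ B, ∀ g, w (k * b * k⁻¹ * g) = w g) : ∑ m, z.coeff m • w m = 0 := by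
  let f : cIndV B.subtype (Representation.trivial R B W) :=
    ⟨fun g => w (k * g), fun b g => by
      simpa only [mul_assoc, inv_mul_cancel_left, Subgroup.subtype_apply,
        Representation.trivial_apply] using hw b b.2 (k * g),
      Finset.univ, fun g _ => ⟨1, g, Finset.mem_univ g, (one_mul g).symm⟩⟩
  have hzf : (∑ m, z.coeff m • cInd B.subtype (Representation.trivial R B W) m f).1 k⁻¹ = 0 := by
    rw [← asAlgebraHom_apply_eq_sum, RingHom.mem_ker.1 hz]
    rfl
  rw [← Submodule.subtype_apply, map_sum, Finset.sum_apply] at hzf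
  rw [← hzf]
  refine Finset.sum_congr rfl fun m _ => ?_
  change _ = z.coeff m • w (k * (k⁻¹ * m))
  rw [mul_inv_cancel_left]

variable {F : Type*} [Field F] [ValuativeRel F] {n : ℕ} {R : Type*} [Field R]

theorem sum_coeff_smul_padicP_eq_zero [Fintype (FinGL 𝓀[F] n)]
    {a : FinGL 𝓀[F] n → GL (Fin n) 𝒪[F]} (ha : Function.RightInverse a (redK F n))
    {z : MonoidAlgebra R (FinGL 𝓀[F] n)} (hz : z ∈ groupAnn (finP 𝓀[F] n R))
    {x : cIndV (iwahori F n).subtype (Representation.trivial R (iwahori F n) R)}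
    (hx : ∀ u ∈ proRadical F n, padicP F n R u x = x) :
    ∑ m, z.coeff m • padicP F n R (inclK F n (a m)) x = 0 := by
  ext y
  obtain ⟨k, hk⟩ := exists_borel_conj_lift y
  let w (m : FinGL 𝓀[F] n) : R := x.1 (y * inclK F n (a m))
  have apply_mul_inclK (κ : GL (Fin n) 𝒪[F]) : x.1 (y * inclK F n κ) = w (redK F n κ) := by
    have hker : κ⁻¹ * a (redK F n κ) ∈ (redK F n).ker := by
      rw [MonoidHom.mem_ker, map_mul, map_inv, ha, inv_mul_cancel]
    have := congrFun (congrArg Subtype.val (hx _ ⟨_, hker, rfl⟩)) (y * inclK F n κ)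
    rw [← this]
    change x.1 (y * inclK F n κ * inclK F n (κ⁻¹ * a (redK F n κ))) = _
    rw [mul_assoc, ← map_mul, mul_inv_cancel_left]
  have hw (b) (hb : b ∈ borel 𝓀[F] n) (g) :
      w (redK F n k * b * (redK F n k)⁻¹ * g) = w g := by
    obtain ⟨κ, rfl, hκ⟩ := hk b hb
    rw [← ha g, ← map_inv, ← map_mul, ← map_mul, ← map_mul, ← apply_mul_inclK, ← apply_mul_inclK]
    refine Eq.trans (congrArg x.1 ?_) (x.2.1 ⟨_, hκ⟩ (y * inclK F n (a g)))
    rw [map_mul, Subgroup.subtype_apply, mul_assoc _ y⁻¹, inv_mul_cancel_left, mul_assoc y]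
  rw [← Submodule.subtype_apply, map_sum, Finset.sum_apply]
  exact sum_coeff_smul_eq_zero_of_mem_groupAnn hz hw

variable [TopologicalSpace F] [IsNonarchimedeanLocalField F]

variable (F n) in
theorem isOpen_iwahori : IsOpen (iwahori F n : Set (GL (Fin n) F)) :=
  Subgroup.isOpen_mono (Subgroup.map_mono (MonoidHom.ker_le_comap _ _)) (isOpen_proRadical F n)

theorem isSmoothVector_padicP
    (x : cIndV (iwahori F n).subtype (Representation.trivial R (iwahori F n) R)) :
    IsSmoothVector (padicP F n R) x := by
  refine isSmoothVector_cInd (L := ⊤) ?_ (fun h _ => rfl) x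
  rw [← MonoidHom.range_eq_map, Subgroup.range_subtype]
  exact isOpen_iwahori F n

end Iwahori

section TraceOne

open scoped TensorProduct

/-- Higman's criterion for `ρ`: the identity is the sum of the conjugates of some linear
endomorphism. Over a field it is equivalent to projectivity; unlike projectivity it visibly passes
through inflations and inductions. -/
def HasTraceOne {R : Type*} [CommRing R] {G : Type*} [Group G] [Fintype G] {V : Type*}
    [AddCommGroup V] [Module R V] (ρ : Representation R G V) : Prop :=
  ∃ t : Module.End R V, ∀ v, ∑ g, ρ g⁻¹ (t (ρ g v)) = v

theorem projective_of_sum_conjugate_eq {R : Type*} [CommRing R] {G : Type*} [Group G] [Fintype G]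
    {V : Type*} [AddCommGroup V] [Module R V] [Module (MonoidAlgebra R G) V]
    [IsScalarTower R (MonoidAlgebra R G) V] [Module.Projective R V] {t : V →ₗ[R] V}
    (ht : ∀ v, ∑ g : G, t.conjugate g v = v) : Module.Projective (MonoidAlgebra R G) V := by
  let i : V →ₗ[R] MonoidAlgebra R G ⊗[R] V := TensorProduct.mk R (MonoidAlgebra R G) V 1 ∘ₗ t
  let m : MonoidAlgebra R G ⊗[R] V →ₗ[MonoidAlgebra R G] V :=
    TensorProduct.AlgebraTensorModule.lift (LinearMap.toSpanSingleton _ (V →ₗ[R] V) LinearMap.id)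
  refine .of_split (i.sumOfConjugatesEquivariant G) m (LinearMap.ext fun v => ?_)
  rw [LinearMap.comp_apply, LinearMap.sumOfConjugatesEquivariant_apply, map_sum,
    LinearMap.id_apply]
  refine (Finset.sum_congr rfl fun g _ => ?_).trans (ht v)
  rw [LinearMap.conjugate_apply, LinearMap.conjugate_apply, map_smul]
  exact congrArg _ (one_smul _ _)

variable {R : Type*} [CommRing R] {G H M : Type*} [Group G] [Group H] [Group M]
variable [Fintype G] [Fintype H] [Fintype M]
variable {V : Type*} [AddCommGroup V] [Module R V]

theorem HasTraceOne.projective_asModule [Module.Projective R V] {ρ : Representation R G V}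
    (hρ : HasTraceOne ρ) : Module.Projective (MonoidAlgebra R G) ρ.asModule := by
  have : Module.Projective R ρ.asModule := .of_equiv ρ.asModuleEquiv.symm
  obtain ⟨t, ht⟩ := hρ
  refine projective_of_sum_conjugate_eq
    (t := ρ.asModuleEquiv.symm.toLinearMap ∘ₗ t ∘ₗ ρ.asModuleEquiv.toLinearMap) fun v => ?_
  refine Eq.trans (Finset.sum_congr rfl fun g _ => ?_) (ht v)
  rw [LinearMap.conjugate_apply, Representation.single_smul, Representation.single_smul, one_smul,
    one_smul]
  rfl

theorem hasTraceOne_of_isUnit_card (hG : IsUnit (Nat.card G : R)) (ρ : Representation R G V) :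
    HasTraceOne ρ := by
  refine ⟨hG.unit⁻¹.1 • 1, fun v => ?_⟩
  simp only [LinearMap.smul_apply, Module.End.one_apply, map_smul, Representation.inv_self_apply,
    Finset.sum_const, Finset.card_univ, ← Nat.card_eq_fintype_card]
  rw [← Nat.cast_smul_eq_nsmul R, smul_smul, IsUnit.mul_val_inv, one_smul]

theorem HasTraceOne.comp {ρ : Representation R M V} (hρ : HasTraceOne ρ) {q : H →* M}
    (hq : Function.Surjective q) (hker : IsUnit (Nat.card q.ker : R)) : HasTraceOne (ρ.comp q) := by
  classical
  obtain ⟨t, ht⟩ := hρ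
  refine ⟨hker.unit⁻¹.1 • t, fun v => ?_⟩
  have hfiber (m : M) : (Finset.univ.filter fun h => q h = m).card = Nat.card q.ker := by
    obtain ⟨h, rfl⟩ := hq m
    rw [MonoidHom.card_fiber_eq_of_mem_range q ⟨h, rfl⟩ ⟨1, map_one q⟩, Nat.card_eq_fintype_card,
      Fintype.card_subtype]
    simp only [MonoidHom.mem_ker]
  calc ∑ h, (ρ.comp q) h⁻¹ ((hker.unit⁻¹.1 • t) ((ρ.comp q) h v))
      = ∑ h, hker.unit⁻¹.1 • ρ (q h)⁻¹ (t (ρ (q h) v)) := by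
        simp only [MonoidHom.comp_apply, map_inv, LinearMap.smul_apply, map_smul]
    _ = hker.unit⁻¹.1 • ∑ m, Nat.card q.ker • ρ m⁻¹ (t (ρ m v)) := by
        rw [← Finset.smul_sum, ← Finset.sum_fiberwise (g := q)]
        refine congrArg _ (Finset.sum_congr rfl fun m _ => ?_)
        rw [← hfiber m, ← Finset.sum_const]
        exact Finset.sum_congr rfl fun h hh => by rw [(Finset.mem_filter.1 hh).2]
    _ = v := by
        rw [← Finset.smul_sum, ht, ← Nat.cast_smul_eq_nsmul R, smul_smul, IsUnit.val_inv_mul,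
          one_smul]

theorem HasTraceOne.cInd {ρ : Representation R H V} (hρ : HasTraceOne ρ) {φ : H →* G}
    (hφ : Function.Injective φ) : HasTraceOne (cInd φ ρ) := by
  obtain ⟨t, ht⟩ := hρ
  refine ⟨cIndSingle hφ ρ ∘ₗ t ∘ₗ LinearMap.proj 1 ∘ₗ (cIndV φ ρ).subtype, fun f => ?_⟩
  ext x
  rw [← Submodule.subtype_apply, map_sum, Finset.sum_apply]
  calc ∑ g, (cIndSingle hφ ρ (t (f.1 (1 * g)))).1 (x * g⁻¹)
      = ∑ g, (cIndSingle hφ ρ (t (f.1 (g * x)))).1 g⁻¹ :=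
        Fintype.sum_equiv (Equiv.mulRight x⁻¹) _ _ fun g => by simp
    _ = ∑ h, ρ h⁻¹ (t (ρ h (f.1 x))) := by
        refine (Fintype.sum_of_injective φ hφ _ _ (fun g hg => ?_) fun h => ?_).symm
        · exact cIndSingle_apply_of_notMem_range hφ _ fun hg' => hg (inv_mem_iff.1 hg')
        · rw [← map_inv, cIndSingle_apply_map, f.2.1]
    _ = f.1 x := ht (f.1 x)

theorem HasTraceOne.directSum {ι : Type*} {W : ι → Type*} [∀ i, AddCommGroup (W i)]
    [∀ i, Module R (W i)] {ρ : ∀ i, Representation R G (W i)} (hρ : ∀ i, HasTraceOne (ρ i)) :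
    HasTraceOne (Representation.directSum ρ) := by
  choose t ht using hρ
  refine ⟨DirectSum.lmap t, fun v => DFunLike.ext _ _ fun i => ?_⟩
  exact (DirectSum.sum_apply _ _ i).trans (ht i (v i))

end TraceOne

section FiniteGamma

theorem composition_index_monotone {n : ℕ} (c : Composition n) : Monotone c.index := by
  intro i j hij
  by_contra! h
  have hsize : c.sizeUpTo (c.index j).succ ≤ c.sizeUpTo (c.index i) := c.monotone_sizeUpTo h
  exact absurd hij (not_le.2 <|
    (c.lt_sizeUpTo_index_succ j).trans_le (hsize.trans (c.sizeUpTo_index_le i)))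

section Unipotent

variable {A : Type*} [CommRing A] {n : ℕ}

theorem pow_eq_zero_of_strictlyUpperTriangular {N : Matrix (Fin n) (Fin n) A}
    (hN : N.BlockTriangular id) (hdiag : ∀ i, N i i = 0) : N ^ n = 0 := by
  have hchar := Matrix.aeval_self_charpoly N
  rw [Matrix.charpoly_of_isUpperTriangular N hN] at hchar
  simpa [hdiag] using hchar

theorem isPGroup_of_upperUnitriangular {p : ℕ} [Fact p.Prime] [CharP A p] {U : Type*} [Group U]
    {f : U →* GL (Fin n) A} (hf : Function.Injective f)
    (htri : ∀ u, (f u : Matrix (Fin n) (Fin n) A).BlockTriangular id)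
    (hdiag : ∀ u i, (f u : Matrix (Fin n) (Fin n) A) i i = 1) : IsPGroup p U := by
  intro u
  refine ⟨n, hf (Units.ext ?_)⟩
  have hpow : ((f u).1 - 1) ^ n = 0 := pow_eq_zero_of_strictlyUpperTriangular
    ((htri u).sub Matrix.blockTriangular_one) fun i => by
      rw [Matrix.sub_apply, hdiag, Matrix.one_apply_eq, sub_self]
  rw [map_pow, map_one, Units.val_pow_eq_pow_val, Units.val_one]
  rcases isEmpty_or_nonempty (Fin n) with he | he
  · exact Subsingleton.elim _ _
  rw [← sub_add_cancel (f u).1 1, add_pow_char_pow_of_commute _ _ (Commute.one_right _), one_pow,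
    pow_eq_zero_of_le (Nat.lt_pow_self (Fact.out : p.Prime).one_lt).le hpow, zero_add]

end Unipotent

variable {k : Type*} [Field k] {n : ℕ}

theorem isPGroup_leviUnip (p : ℕ) [Fact p.Prime] [CharP k p] {α : Type*} [LinearOrder α]
    (b : Fin n → α) : IsPGroup p (leviUnip k b) :=
  isPGroup_of_upperUnitriangular (f := (levi k b).subtype.comp (leviUnip k b).subtype)
    ((levi k b).subtype_injective.comp (leviUnip k b).subtype_injective) (fun u => u.2.1)
    fun u => u.2.2

theorem leviProj_surjective {α : Type*} [LinearOrder α] (b : Fin n → α) :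
    Function.Surjective (leviProj k b) := by
  intro m
  refine ⟨⟨m.1, fun i j h => m.2 i j h.ne'⟩, ?_⟩
  ext i j
  exact ite_eq_left_iff.2 fun h => (m.2 i j h).symm

theorem isPGroup_ker_leviProj (p : ℕ) [Fact p.Prime] [CharP k p] {α : Type*} [LinearOrder α]
    {b : Fin n → α} (hb : Monotone b) : IsPGroup p (leviProj k b).ker := by
  have apply_of_eq (u : (leviProj k b).ker) {i j : Fin n} (hij : b i = b j) :
      u.1.1.1 i j = (1 : Matrix (Fin n) (Fin n) k) i j := by
    have := congrArg (fun m => m.1.1 i j) (MonoidHom.mem_ker.1 u.2)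
    exact (if_pos hij).symm.trans this
  refine isPGroup_of_upperUnitriangular
    (f := (parabolic k b).subtype.comp (leviProj k b).ker.subtype)
    ((parabolic k b).subtype_injective.comp (leviProj k b).ker.subtype_injective)
    (fun u i j hij => ?_) fun u i => (apply_of_eq u rfl).trans (Matrix.one_apply_eq i)
  rcases (hb hij.le).lt_or_eq with h | h
  · exact u.1.2 h
  · exact (apply_of_eq u h.symm).trans (Matrix.one_apply_ne hij.ne')

theorem isUnit_card_of_isPGroup {R : Type*} [Field R] {p : ℕ} [Fact p.Prime] (hp : (p : R) ≠ 0)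
    {U : Type*} [Group U] [Finite U] (hU : IsPGroup p U) : IsUnit (Nat.card U : R) := by
  obtain ⟨m, hm⟩ := IsPGroup.iff_card.1 hU
  rw [hm, Nat.cast_pow]
  exact (pow_ne_zero m hp).isUnit

theorem projective_finGamma [Finite k] {p : ℕ} [CharP k p] {R : Type*} [Field R]
    (hp : (p : R) ≠ 0) :
    Module.Projective (MonoidAlgebra R (GL (Fin n) k)) (finGamma k n R).asModule := by
  have : Fact p.Prime := ⟨CharP.char_is_prime k p⟩
  have := Fintype.ofFinite (GL (Fin n) k)
  refine HasTraceOne.projective_asModule (HasTraceOne.directSum fun i => ?_)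
  have := Fintype.ofFinite (levi k i.1.index)
  have := Fintype.ofFinite (leviUnip k i.1.index)
  have := Fintype.ofFinite (parabolic k i.1.index)
  have hχ : HasTraceOne (charRep i.2.1) := hasTraceOne_of_isUnit_card
    (isUnit_card_of_isPGroup hp (isPGroup_leviUnip p _)) _
  exact ((hχ.cInd (leviUnip k i.1.index).subtype_injective).comp (leviProj_surjective _)
    (isUnit_card_of_isPGroup hp (isPGroup_ker_leviProj p (composition_index_monotone i.1)))).cInd
    (parabolic k i.1.index).subtype_injective

end FiniteGamma

end ParahoricGen

end

theorem mainTheorem4_general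
    (F : Type*) [Field F] [ValuativeRel F] [TopologicalSpace F] [IsNonarchimedeanLocalField F]
    (R : Type*) [Field R] (p : ℕ) [CharP 𝓀[F] p] (hp : (p : R) ≠ 0) (n : ℕ)
    {V : Type*} [AddCommGroup V] [Module R V]
    (ρ : Representation R (ParahoricGen.FinGL 𝓀[F] n) V)
    [Module.Projective (MonoidAlgebra R (ParahoricGen.FinGL 𝓀[F] n)) ρ.asModule] :
    ∃ e : ((ParahoricGen.parahoricInd ρ).quotient
          (ParahoricGen.heckeAnnSpan (ParahoricGen.proRadical F n) (ParahoricGen.padicP F n R)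
            (ParahoricGen.parahoricInd ρ)) (ParahoricGen.heckeAnnSpan_stable _ _ _)).Equiv
        (ParahoricGen.parahoricInd (ρ.quotient
          (ParahoricGen.groupAnnSpan (ParahoricGen.finP 𝓀[F] n R) ρ)
          (ParahoricGen.groupAnnSpan_stable _ _))),
      ∀ v : ParahoricGen.ParahoricIndV ρ,
        e (ParahoricGen.quotientMap _ _ (ParahoricGen.heckeAnnSpan_stable _ _ _) v) =
          ParahoricGen.parahoricIndMap
            (ParahoricGen.quotientMap ρ _ (ParahoricGen.groupAnnSpan_stable _ _)) v := by
  have := Fintype.ofFinite (ParahoricGen.FinGL 𝓀[F] n)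
  have ha := Function.rightInverse_surjInv (ParahoricGen.redK_surjective (F := F) (n := n))
  refine ParahoricGen.exists_quotient_equiv _ (ParahoricGen.cIndMap_surjective
    ParahoricGen.inclK_injective (Submodule.mkQ_surjective _)) _ fun v => ?_
  rw [Subtype.ext_iff, funext_iff]
  refine (ParahoricGen.mem_heckeAnnSpan_cInd_iff ParahoricGen.inclK_injective ha
    (ParahoricGen.admitsHaarMeasure_proRadical hp) (ParahoricGen.isCompact_proRadical F n)
    ParahoricGen.isSmoothVector_padicP
    (ParahoricGen.cIndStages_injective _ ParahoricGen.redK_surjective _)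
    fun z hz x => ParahoricGen.sum_coeff_smul_padicP_eq_zero ha hz).trans ?_
  exact forall_congr' fun g => (Submodule.Quotient.mk_eq_zero _).symm

theorem mainTheorem4
    (F : Type*) [Field F] [ValuativeRel F] [TopologicalSpace F] [IsNonarchimedeanLocalField F]
    (R : Type*) [Field R] [IsAlgClosed R]
    (p l : ℕ) [CharP 𝓀[F] p] [CharP R l] (hlp : l ≠ p) (n : ℕ) :
    ∃ e : (ParahoricGen.padicQ F n R).Equiv
        (ParahoricGen.parahoricInd (ParahoricGen.finQ 𝓀[F] n R)),
      ∀ v : ParahoricGen.PadicGammaV F n R,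
        e (ParahoricGen.padicQuotientMap F n R v) =
          ParahoricGen.parahoricIndMap (ParahoricGen.finQuotientMap 𝓀[F] n R) v := by
  have hp : (p : R) ≠ 0 := CharP.cast_ne_zero_of_ne_of_prime R (CharP.char_is_prime 𝓀[F] p) hlp
  have := ParahoricGen.projective_finGamma (k := 𝓀[F]) (n := n) hp
  exact mainTheorem4_general F R p hp n (ParahoricGen.finGamma 𝓀[F] n R)
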